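/- Let $(M^{2n},\omega)$ be a symplectic manifold, $1\le k\le n$. Let $(\Omega^*(M),d)$ be the de Rham complex, $H^q(M)$ its cohomology, $b_q(M)=\dim H^q(M)$, and $L_\omega^k(\alpha)=\alpha\wedge\omega^k$. The $k$-coeffective $q$-forms are $\mathfrak C^q_{(k)}(M)=\{\alpha\in\Omega^q(M):\alpha\wedge\omega^k=0\}$; they form a subcomplex of $(\Omega^*(M),d)$, with cohomology $$H^q_{(k)}(M)=\frac{\ker\{d:\mathfrak C^q_{(k)}(M)\to\mathfrak C^{q+1}_{(k)}(M)\}}{\operatorname{im}\{d:\mathfrak C^{q-1}_{(k)}(M)\to\mathfrak C^{q}_{(k)}(M)\}}.$$ Let $f_{n-k+1}:H^{n+k}(L_\omega^k(\Omega^*(M)))\to H^{n-k+1}_{(k)}(M)$, $[\beta\wedge\omega^k]\mapsto[d\beta]$ (where $\beta\in\Omega^{n-k}(M)$ and $\beta\wedge\omega^k$ is closed), be the connecting homomorphism of the short exact sequence $0\to\mathfrak C^*_{(k)}(M)\to\Omega^*(M)\xrightarrow{L_\omega^k}L_\omega^k(\Omega^*(M))\to0$. Its kernel is the image of $H^{n-k}(M)$.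 Put $$\hat H^{n-k+1}(M)=H^{n-k+1}_{(k)}(M)/\operatorname{im} f_{n-k+1}=\frac{H^{n-k+1}_{(k)}(M)}{H^{n+k}(L_\omega^k(\Omega^*(M)))/H^{n-k}(M)}.$$ Write $c_q^{(k)}(M)=\dim H^q_{(k)}(M)$ and $\hat c_{n-k+1}(M)=\dim\hat H^{n-k+1}(M)$ when these are finite. $M$ is of finite type if all $b_q(M)$ are finite. $(M,\omega)$ satisfies the Hard Lefschetz Condition (HLC) if $H^{n-j}(M)\to H^{n+j}(M)$, $[\alpha]\mapsto[\alpha\wedge\omega^j]$, is surjective for every $1\le j\le n$. **Proposition.** Let $(M^{2n},\omega)$ be a symplectic manifold of finite type and let $1\le k\le n$. (A) For every $q\ge n-k+2$: (i) $H^q_{(k)}(M)$ is finite dimensional and $b_q(M)-b_{q+2k}(M)\le c_q^{(k)}(M)\le b_q(M)+b_{q+2k-1}(M)$. (ii) If $(M,\omega)$ satisfies the HLC, then $c_q^{(k)}(M)=b_q(M)-b_{q+2k}(M)$. (iii) If $\omega$ is exact, then $c_q^{(k)}(M)=b_q(M)+b_{q+2k-1}(M)$. (iv) If $U$ is the open unit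 disk in $\mathbb R^{2n}$ with the standard symplectic form $\sum_{i=1}^n dx^i\wedge dx^{n+i}$, then $c_q^{(k)}(U)=0$. (B) Moreover: (i) $\hat H^{n-k+1}(M)$ is finite dimensional and $b_{n-k+1}(M)-b_{n+k+1}(M)\le\hat c_{n-k+1}(M)\le b_{n-k+1}(M)$. (ii) If $(M,\omega)$ satisfies the HLC, then $\hat c_{n-k+1}(M)=b_{n-k+1}(M)-b_{n+k+1}(M)$. (iii) If $\omega$ is exact, then $\hat c_{n-k+1}(M)=b_{n-k+1}(M)$. (iv) For the disk $U$ with its standard symplectic form, $\hat c_{n-k+1}(U)=0$. -/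

import Mathlib

open Set
open scoped Manifold ContDiff

noncomputable section

namespace Coeff

section Algebra

variable {E E' : Type*} [AddCommGroup E] [Module ℝ E] [TopologicalSpace E]
  [AddCommGroup E'] [Module ℝ E'] [TopologicalSpace E']

/-- The multilinear map `(v₁, …, v_{p+q}) ↦ α (v₁, …, v_p) * β (v_{p+1}, …, v_{p+q})`. -/
def tensorForm {p q : ℕ} (α : E [⋀^Fin p]→L[ℝ] ℝ) (β : E [⋀^Fin q]→L[ℝ] ℝ) :
    ContinuousMultilinearMap ℝ (fun _ : Fin (p + q) => E) ℝ where
  toMultilinearMap :=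
    ((LinearMap.mul' ℝ ℝ).compMultilinearMap
      (MultilinearMap.domCoprod α.toAlternatingMap.toMultilinearMap
        β.toAlternatingMap.toMultilinearMap)).domDomCongr finSumFinEquiv
  cont := by
    have h : Continuous fun v : Fin (p + q) → E =>
        α (fun i => v (Fin.castAdd q i)) * β (fun i => v (Fin.natAdd p i)) := by fun_prop
    exact h

theorem tensorForm_apply {p q : ℕ} (α : E [⋀^Fin p]→L[ℝ] ℝ) (β : E [⋀^Fin q]→L[ℝ] ℝ)
    (v : Fin (p + q) → E) :
    tensorForm α β v =
      α (fun i => v (Fin.castAdd q i)) * β (fun i => v (Fin.natAdd p i)) := rfl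

/-- The wedge product of alternating forms, in the normalization
`(α ∧ β)(v₁, …, v_{p+q}) =
  (1 / (p! q!)) ∑_τ sign τ * α (v_{τ 1}, …, v_{τ p}) * β (v_{τ (p+1)}, …, v_{τ (p+q)})`,
that is, the sum over all `(p, q)`-shuffles. -/
def wedgeAlt {p q : ℕ} (α : E [⋀^Fin p]→L[ℝ] ℝ) (β : E [⋀^Fin q]→L[ℝ] ℝ) :
    E [⋀^Fin (p + q)]→L[ℝ] ℝ :=
  ((p.factorial : ℝ) * (q.factorial : ℝ))⁻¹ •
    ContinuousMultilinearMap.alternatization (tensorForm α β)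

theorem wedgeAlt_apply {p q : ℕ} (α : E [⋀^Fin p]→L[ℝ] ℝ) (β : E [⋀^Fin q]→L[ℝ] ℝ)
    (v : Fin (p + q) → E) :
    wedgeAlt α β v = ((p.factorial : ℝ) * (q.factorial : ℝ))⁻¹ *
      ∑ τ : Equiv.Perm (Fin (p + q)), ((Equiv.Perm.sign τ : ℤ) : ℝ) *
        (α (fun i => v (τ (Fin.castAdd q i))) * β (fun i => v (τ (Fin.natAdd p i)))) := by
  simp only [wedgeAlt, ContinuousAlternatingMap.smul_apply, smul_eq_mul,
    ContinuousMultilinearMap.alternatization_apply_apply, tensorForm_apply, Function.comp]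
  congr 1
  refine Finset.sum_congr rfl fun τ _ => ?_
  rw [Units.smul_def, zsmul_eq_mul]

theorem wedgeAlt_comp {p q : ℕ} (α : E [⋀^Fin p]→L[ℝ] ℝ) (β : E [⋀^Fin q]→L[ℝ] ℝ)
    (A : E' →L[ℝ] E) :
    (wedgeAlt α β).compContinuousLinearMap A =
      wedgeAlt (α.compContinuousLinearMap A) (β.compContinuousLinearMap A) := by
  ext v
  simp only [ContinuousAlternatingMap.compContinuousLinearMap_apply, wedgeAlt_apply]
  rfl

theorem wedgeAlt_add_left {p q : ℕ} (α α' : E [⋀^Fin p]→L[ℝ] ℝ) (β : E [⋀^Fin q]→L[ℝ] ℝ) :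
    wedgeAlt (α + α') β = wedgeAlt α β + wedgeAlt α' β := by
  ext v
  simp only [ContinuousAlternatingMap.add_apply, wedgeAlt_apply, add_mul, mul_add,
    Finset.sum_add_distrib]

theorem wedgeAlt_add_right {p q : ℕ} (α : E [⋀^Fin p]→L[ℝ] ℝ) (β β' : E [⋀^Fin q]→L[ℝ] ℝ) :
    wedgeAlt α (β + β') = wedgeAlt α β + wedgeAlt α β' := by
  ext v
  simp only [ContinuousAlternatingMap.add_apply, wedgeAlt_apply, mul_add,
    Finset.sum_add_distrib]

theorem wedgeAlt_smul_left {p q : ℕ} (c : ℝ) (α : E [⋀^Fin p]→L[ℝ] ℝ)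
    (β : E [⋀^Fin q]→L[ℝ] ℝ) : wedgeAlt (c • α) β = c • wedgeAlt α β := by
  ext v
  simp only [ContinuousAlternatingMap.smul_apply, wedgeAlt_apply, smul_eq_mul, Finset.mul_sum]
  exact Finset.sum_congr rfl fun τ _ => by ring

theorem wedgeAlt_smul_right {p q : ℕ} (c : ℝ) (α : E [⋀^Fin p]→L[ℝ] ℝ)
    (β : E [⋀^Fin q]→L[ℝ] ℝ) : wedgeAlt α (c • β) = c • wedgeAlt α β := by
  ext v
  simp only [ContinuousAlternatingMap.smul_apply, wedgeAlt_apply, smul_eq_mul, Finset.mul_sum]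
  exact Finset.sum_congr rfl fun τ _ => by ring

end Algebra

section Normed

variable {E : Type*} [NormedAddCommGroup E] [NormedSpace ℝ E]

theorem norm_wedgeAlt_le {p q : ℕ} (α : E [⋀^Fin p]→L[ℝ] ℝ) (β : E [⋀^Fin q]→L[ℝ] ℝ) :
    ‖wedgeAlt α β‖ ≤ ((p + q).factorial : ℝ) * ‖α‖ * ‖β‖ := by
  refine ContinuousAlternatingMap.opNorm_le_bound _
    (mul_nonneg (mul_nonneg (Nat.cast_nonneg _) (norm_nonneg _)) (norm_nonneg _)) fun v => ?_
  rw [wedgeAlt_apply, norm_mul]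
  have h1 : ‖((p.factorial : ℝ) * (q.factorial : ℝ))⁻¹‖ ≤ 1 := by
    rw [norm_inv, Real.norm_of_nonneg (by positivity)]
    apply inv_le_one_of_one_le₀
    have hp : (1 : ℝ) ≤ p.factorial := by exact_mod_cast Nat.one_le_iff_ne_zero.2 p.factorial_ne_zero
    have hq : (1 : ℝ) ≤ q.factorial := by exact_mod_cast Nat.one_le_iff_ne_zero.2 q.factorial_ne_zero
    nlinarith
  have h2 : ‖∑ τ : Equiv.Perm (Fin (p + q)), ((Equiv.Perm.sign τ : ℤ) : ℝ) *
        (α (fun i => v (τ (Fin.castAdd q i))) * β (fun i => v (τ (Fin.natAdd p i))))‖ ≤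
      ∑ _τ : Equiv.Perm (Fin (p + q)), ‖α‖ * ‖β‖ * ∏ i, ‖v i‖ := by
    refine norm_sum_le_of_le _ fun τ _ => ?_
    have hs : ‖((Equiv.Perm.sign τ : ℤ) : ℝ)‖ = 1 := by
      rcases Int.units_eq_one_or (Equiv.Perm.sign τ) with h | h <;> simp [h]
    rw [norm_mul, hs, one_mul, norm_mul]
    have ha := α.le_opNorm (fun i => v (τ (Fin.castAdd q i)))
    have hb := β.le_opNorm (fun i => v (τ (Fin.natAdd p i)))
    calc _ ≤ (‖α‖ * ∏ i, ‖v (τ (Fin.castAdd q i))‖) * (‖β‖ * ∏ i, ‖v (τ (Fin.natAdd p i))‖) := by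
          gcongr
      _ = ‖α‖ * ‖β‖ * ∏ i, ‖v (τ i)‖ := by
          rw [Fin.prod_univ_add]; ring
      _ = _ := by rw [Equiv.prod_comp τ fun i => ‖v i‖]
  have h3 : ∑ _τ : Equiv.Perm (Fin (p + q)), ‖α‖ * ‖β‖ * ∏ i, ‖v i‖ =
      ((p + q).factorial : ℝ) * ‖α‖ * ‖β‖ * ∏ i, ‖v i‖ := by
    rw [Finset.sum_const, Finset.card_univ, Fintype.card_perm, Fintype.card_fin, nsmul_eq_mul]
    ring
  calc _ ≤ 1 * _ := mul_le_mul h1 (h2.trans h3.le) (norm_nonneg _) zero_le_one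
    _ = _ := one_mul _

/-- The wedge product as a continuous bilinear map. -/
def wedgeCLM (E : Type*) [NormedAddCommGroup E] [NormedSpace ℝ E] (p q : ℕ) :
    (E [⋀^Fin p]→L[ℝ] ℝ) →L[ℝ] (E [⋀^Fin q]→L[ℝ] ℝ) →L[ℝ] (E [⋀^Fin (p + q)]→L[ℝ] ℝ) :=
  LinearMap.mkContinuous₂
    (LinearMap.mk₂ ℝ wedgeAlt wedgeAlt_add_left wedgeAlt_smul_left wedgeAlt_add_right
      wedgeAlt_smul_right)
    ((p + q).factorial : ℝ) (fun α β => norm_wedgeAlt_le α β)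

end Normed

section Forms

variable {E : Type*} [NormedAddCommGroup E] [NormedSpace ℝ E]
  {M : Type*} [TopologicalSpace M] [ChartedSpace E M]

/-- A (not necessarily smooth) differential `q`-form on `M`. -/
def RawForm (E : Type*) [NormedAddCommGroup E] [NormedSpace ℝ E]
    (M : Type*) [TopologicalSpace M] [ChartedSpace E M] (q : ℕ) : Type _ :=
  ∀ x : M, TangentSpace 𝓘(ℝ, E) x [⋀^Fin q]→L[ℝ] ℝ

instance (q : ℕ) : AddCommGroup (RawForm E M q) :=
  inferInstanceAs (AddCommGroup (∀ x : M, TangentSpace 𝓘(ℝ, E) x [⋀^Fin q]→L[ℝ] ℝ))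

instance (q : ℕ) : Module ℝ (RawForm E M q) :=
  inferInstanceAs (Module ℝ (∀ x : M, TangentSpace 𝓘(ℝ, E) x [⋀^Fin q]→L[ℝ] ℝ))

/-- The pullback of a form under the inverse of the chart at `x₀`. -/
def chartRep {q : ℕ} (α : RawForm E M q) (x₀ : M) (y : E) : E [⋀^Fin q]→L[ℝ] ℝ :=
  (α ((extChartAt 𝓘(ℝ, E) x₀).symm y)).compContinuousLinearMap
    (mfderiv 𝓘(ℝ, E) 𝓘(ℝ, E) (extChartAt 𝓘(ℝ, E) x₀).symm y)

/-- A form is smooth if it is smooth when read in the charts. -/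
def IsSmoothForm {q : ℕ} (α : RawForm E M q) : Prop :=
  ∀ x₀ : M, ContDiffOn ℝ ∞ (chartRep α x₀) (extChartAt 𝓘(ℝ, E) x₀).target

theorem chartRep_add {q : ℕ} (α β : RawForm E M q) (x₀ : M) :
    chartRep (α + β) x₀ = chartRep α x₀ + chartRep β x₀ := rfl

theorem chartRep_smul {q : ℕ} (c : ℝ) (α : RawForm E M q) (x₀ : M) :
    chartRep (c • α) x₀ = c • chartRep α x₀ := rfl

theorem chartRep_zero {q : ℕ} (x₀ : M) :
    chartRep (0 : RawForm E M q) x₀ = 0 := rfl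

/-- The space `Ω^q(M)` of smooth differential `q`-forms. -/
def Form (E : Type*) [NormedAddCommGroup E] [NormedSpace ℝ E]
    (M : Type*) [TopologicalSpace M] [ChartedSpace E M] (q : ℕ) :
    Submodule ℝ (RawForm E M q) where
  carrier := {α | IsSmoothForm α}
  add_mem' {α β} ha hb x₀ := by
    rw [chartRep_add]; exact (ha x₀).add (hb x₀)
  zero_mem' x₀ := by
    rw [chartRep_zero]; exact contDiffOn_const
  smul_mem' c α ha x₀ := by
    rw [chartRep_smul]; exact (ha x₀).const_smul c

/-- The exterior derivative: at `x`, read the form in the chart at `x`, differentiate it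
there, and pull the result back to `M`. -/
def rawExtDeriv {q : ℕ} (α : RawForm E M q) : RawForm E M (q + 1) := fun x =>
  (extDeriv (chartRep α x) (extChartAt 𝓘(ℝ, E) x x)).compContinuousLinearMap
    (mfderiv 𝓘(ℝ, E) 𝓘(ℝ, E) (extChartAt 𝓘(ℝ, E) x) x)

theorem chartRep_wedge {p q : ℕ} (α : RawForm E M p) (β : RawForm E M q) (x₀ : M) (y : E) :
    chartRep (fun x => wedgeAlt (α x) (β x)) x₀ y =
      wedgeCLM E p q (chartRep α x₀ y) (chartRep β x₀ y) :=
  wedgeAlt_comp _ _ _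

/-- The wedge product of smooth forms. -/
def wedge {p q : ℕ} (α : Form E M p) (β : Form E M q) : Form E M (p + q) :=
  ⟨fun x => wedgeAlt (α.1 x) (β.1 x), fun x₀ => by
    have h := ((wedgeCLM E p q).isBoundedBilinearMap.contDiff (n := ∞)).comp_contDiffOn
      ((α.2 x₀).prodMk (β.2 x₀))
    exact h.congr fun y _ => chartRep_wedge _ _ _ _⟩

/-- Wedge product on the right by a fixed form, as a linear map. -/
def wedgeRight {q : ℕ} (p : ℕ) (β : Form E M q) : Form E M p →ₗ[ℝ] Form E M (p + q) where
  toFun α := wedge α β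
  map_add' _ _ := Subtype.ext (funext fun _ => wedgeAlt_add_left _ _ _)
  map_smul' _ _ := Subtype.ext (funext fun _ => wedgeAlt_smul_left _ _ _)

theorem chartRep_contDiffAt {q : ℕ} (α : Form E M q) {x₀ : M} {y : E}
    (hy : y ∈ (extChartAt 𝓘(ℝ, E) x₀).target) : ContDiffAt ℝ ∞ (chartRep α.1 x₀) y :=
  (α.2 x₀).contDiffAt ((isOpen_extChartAt_target x₀).mem_nhds hy)

variable [IsManifold 𝓘(ℝ, E) ∞ M]

theorem two_le_infty : minSmoothness ℝ 2 ≤ ∞ := by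
  rw [minSmoothness_of_isRCLikeNormedField]
  exact WithTop.coe_le_coe.2 le_top

theorem mdifferentiableAt_symm {x₀ : M} {y : E}
    (hy : y ∈ (extChartAt 𝓘(ℝ, E) x₀).target) :
    MDifferentiableAt 𝓘(ℝ, E) 𝓘(ℝ, E) (extChartAt 𝓘(ℝ, E) x₀).symm y :=
  ((contMDiffOn_extChartAt_symm (I := 𝓘(ℝ, E)) (n := ∞) x₀).contMDiffAt
    ((isOpen_extChartAt_target x₀).mem_nhds hy)).mdifferentiableAt (by simp)

theorem mdifferentiableAt_chart {x₀ x : M} (hx : x ∈ (extChartAt 𝓘(ℝ, E) x₀).source) :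
    MDifferentiableAt 𝓘(ℝ, E) 𝓘(ℝ, E) (extChartAt 𝓘(ℝ, E) x₀) x :=
  (contMDiffAt_extChartAt' (I := 𝓘(ℝ, E)) (n := ∞)
    (by simpa using hx)).mdifferentiableAt (by simp)

/-- The transition map from the chart at `x₀` to the chart at `x`. -/
def trans (E : Type*) [NormedAddCommGroup E] [NormedSpace ℝ E]
    {M : Type*} [TopologicalSpace M] [ChartedSpace E M] (x₀ x : M) : E → E :=
  extChartAt 𝓘(ℝ, E) x ∘ (extChartAt 𝓘(ℝ, E) x₀).symm

theorem fderiv_trans {x₀ x : M} {y : E} (hy : y ∈ (extChartAt 𝓘(ℝ, E) x₀).target)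
    (hx : (extChartAt 𝓘(ℝ, E) x₀).symm y ∈ (extChartAt 𝓘(ℝ, E) x).source) :
    fderiv ℝ (trans E x₀ x) y =
      (mfderiv 𝓘(ℝ, E) 𝓘(ℝ, E) (extChartAt 𝓘(ℝ, E) x) ((extChartAt 𝓘(ℝ, E) x₀).symm y)).comp
        (mfderiv 𝓘(ℝ, E) 𝓘(ℝ, E) (extChartAt 𝓘(ℝ, E) x₀).symm y) := by
  rw [← mfderiv_eq_fderiv]
  exact mfderiv_comp y (mdifferentiableAt_chart hx) (mdifferentiableAt_symm hy)

theorem contDiffAt_trans {x₀ x : M} {y : E} (hy : y ∈ (extChartAt 𝓘(ℝ, E) x₀).target)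
    (hx : (extChartAt 𝓘(ℝ, E) x₀).symm y ∈ (extChartAt 𝓘(ℝ, E) x).source) :
    ContDiffAt ℝ ∞ (trans E x₀ x) y := by
  rw [← contMDiffAt_iff_contDiffAt]
  refine ContMDiffAt.comp y (contMDiffAt_extChartAt' (by simpa using hx)) ?_
  exact (contMDiffOn_extChartAt_symm (I := 𝓘(ℝ, E)) (n := ∞) x₀).contMDiffAt
    ((isOpen_extChartAt_target x₀).mem_nhds hy)

theorem eventually_mem_chart {x₀ x : M} {y : E} (hy : y ∈ (extChartAt 𝓘(ℝ, E) x₀).target)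
    (hx : (extChartAt 𝓘(ℝ, E) x₀).symm y ∈ (extChartAt 𝓘(ℝ, E) x).source) :
    ∀ᶠ z in nhds y, z ∈ (extChartAt 𝓘(ℝ, E) x₀).target ∧
      (extChartAt 𝓘(ℝ, E) x₀).symm z ∈ (extChartAt 𝓘(ℝ, E) x).source := by
  refine Filter.Eventually.and ((isOpen_extChartAt_target x₀).mem_nhds hy) ?_
  exact (mdifferentiableAt_symm hy).continuousAt.eventually
    ((isOpen_extChartAt_source x).mem_nhds hx)

theorem chartRep_trans {q : ℕ} (α : RawForm E M q) {x₀ x : M} {y : E}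
    (hy : y ∈ (extChartAt 𝓘(ℝ, E) x₀).target)
    (hx : (extChartAt 𝓘(ℝ, E) x₀).symm y ∈ (extChartAt 𝓘(ℝ, E) x).source) :
    chartRep α x₀ y =
      (chartRep α x (trans E x₀ x y)).compContinuousLinearMap (fderiv ℝ (trans E x₀ x) y) := by
  have hz : trans E x₀ x y ∈ (extChartAt 𝓘(ℝ, E) x).target :=
    (extChartAt 𝓘(ℝ, E) x).map_source hx
  have hpt : (extChartAt 𝓘(ℝ, E) x).symm (trans E x₀ x y) =
      (extChartAt 𝓘(ℝ, E) x₀).symm y := (extChartAt 𝓘(ℝ, E) x).left_inv hx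
  have hev : (extChartAt 𝓘(ℝ, E) x₀).symm =ᶠ[nhds y]
      (extChartAt 𝓘(ℝ, E) x).symm ∘ trans E x₀ x := by
    filter_upwards [eventually_mem_chart hy hx] with z hz
    exact ((extChartAt 𝓘(ℝ, E) x).left_inv hz.2).symm
  have hd : MDifferentiableAt 𝓘(ℝ, E) 𝓘(ℝ, E) (trans E x₀ x) y :=
    ((contDiffAt_trans hy hx).differentiableAt (by simp)).mdifferentiableAt
  have hD : mfderiv 𝓘(ℝ, E) 𝓘(ℝ, E) ((extChartAt 𝓘(ℝ, E) x).symm ∘ trans E x₀ x) y =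
      (mfderiv 𝓘(ℝ, E) 𝓘(ℝ, E) (extChartAt 𝓘(ℝ, E) x).symm (trans E x₀ x y)).comp
        (mfderiv 𝓘(ℝ, E) 𝓘(ℝ, E) (trans E x₀ x) y) :=
    mfderiv_comp y (mdifferentiableAt_symm hz) hd
  have hD' : ∀ v : E, (mfderiv 𝓘(ℝ, E) 𝓘(ℝ, E) (extChartAt 𝓘(ℝ, E) x₀).symm y v : E) =
      (mfderiv 𝓘(ℝ, E) 𝓘(ℝ, E) (extChartAt 𝓘(ℝ, E) x).symm (trans E x₀ x y)
        (fderiv ℝ (trans E x₀ x) y v) : E) := by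
    intro v
    have h1 : (mfderiv 𝓘(ℝ, E) 𝓘(ℝ, E) (extChartAt 𝓘(ℝ, E) x₀).symm y : E →L[ℝ] E) =
      (mfderiv 𝓘(ℝ, E) 𝓘(ℝ, E) ((extChartAt 𝓘(ℝ, E) x).symm ∘ trans E x₀ x) y : E →L[ℝ] E) :=
      hev.mfderiv_eq
    have h2 := congrArg (fun A : E →L[ℝ] E => A v) (h1.trans hD)
    rw [← mfderiv_eq_fderiv]
    exact h2
  have key : ∀ {a b : M}, a = b → ∀ v : Fin q → E,
      (α a : E [⋀^Fin q]→L[ℝ] ℝ) v = (α b : E [⋀^Fin q]→L[ℝ] ℝ) v := by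
    rintro a _ rfl v; rfl
  ext v
  refine (key hpt.symm _).trans ?_
  exact congrArg (α ((extChartAt 𝓘(ℝ, E) x).symm (trans E x₀ x y)) : E [⋀^Fin q]→L[ℝ] ℝ)
    (funext fun i => hD' (v i))

/-- In every chart, the exterior derivative is the usual one of the local representation. -/
theorem chartRep_rawExtDeriv {q : ℕ} (α : Form E M q) {x₀ : M} {y : E}
    (hy : y ∈ (extChartAt 𝓘(ℝ, E) x₀).target) :
    chartRep (rawExtDeriv α.1) x₀ y = extDeriv (chartRep α.1 x₀) y := by
  set x := (extChartAt 𝓘(ℝ, E) x₀).symm y with hxdef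
  have hx : (extChartAt 𝓘(ℝ, E) x₀).symm y ∈ (extChartAt 𝓘(ℝ, E) x).source :=
    mem_extChartAt_source (I := 𝓘(ℝ, E)) x
  have hz : trans E x₀ x y ∈ (extChartAt 𝓘(ℝ, E) x).target :=
    (extChartAt 𝓘(ℝ, E) x).map_source hx
  have hev : chartRep α.1 x₀ =ᶠ[nhds y] fun z =>
      (chartRep α.1 x (trans E x₀ x z)).compContinuousLinearMap
        (fderiv ℝ (trans E x₀ x) z) := by
    filter_upwards [eventually_mem_chart hy hx] with z hz
    exact chartRep_trans α.1 hz.1 hz.2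
  rw [hev.extDeriv_eq, extDeriv_pullback (r := ∞)
    ((chartRep_contDiffAt α hz).differentiableAt (by simp)) (contDiffAt_trans hy hx) two_le_infty,
    fderiv_trans hy hx]
  rfl

/-- The exterior derivative `d : Ω^q(M) → Ω^{q+1}(M)`. -/
def d (E : Type*) [NormedAddCommGroup E] [NormedSpace ℝ E]
    (M : Type*) [TopologicalSpace M] [ChartedSpace E M] [IsManifold 𝓘(ℝ, E) ∞ M] (q : ℕ) :
    Form E M q →ₗ[ℝ] Form E M (q + 1) where
  toFun α := ⟨rawExtDeriv α.1, fun x₀ => by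
    have h : ContDiffOn ℝ ∞ (extDeriv (chartRep α.1 x₀)) (extChartAt 𝓘(ℝ, E) x₀).target :=
      (ContinuousAlternatingMap.alternatizeUncurryFinCLM ℝ E ℝ).contDiff.comp_contDiffOn
        ((α.2 x₀).fderiv_of_isOpen (isOpen_extChartAt_target x₀) (by simp))
    exact h.congr fun y hy => chartRep_rawExtDeriv α hy⟩
  map_add' α β := by
    refine Subtype.ext (funext fun x => ?_)
    have hα := (chartRep_contDiffAt α (mem_extChartAt_target (I := 𝓘(ℝ, E)) x)).differentiableAt
      (by simp)
    have hβ := (chartRep_contDiffAt β (mem_extChartAt_target (I := 𝓘(ℝ, E)) x)).differentiableAt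
      (by simp)
    change (extDeriv (chartRep α.1 x + chartRep β.1 x) _).compContinuousLinearMap _ = _
    rw [extDeriv_add hα hβ]
    rfl
  map_smul' c α := by
    refine Subtype.ext (funext fun x => ?_)
    change (extDeriv (c • chartRep α.1 x) _).compContinuousLinearMap _ = _
    rw [extDeriv_smul]
    rfl

/-- A smooth function, as a smooth `0`-form. -/
def ofFun (f : C^∞⟮𝓘(ℝ, E), M; 𝓘(ℝ, ℝ), ℝ⟯) : Form E M 0 :=
  ⟨fun x => ContinuousAlternatingMap.constOfIsEmpty ℝ (TangentSpace 𝓘(ℝ, E) x) (Fin 0) (f x),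
    fun x₀ => by
      have h : ContDiffOn ℝ ∞ (fun y => f ((extChartAt 𝓘(ℝ, E) x₀).symm y))
          (extChartAt 𝓘(ℝ, E) x₀).target := by
        rw [← contMDiffOn_iff_contDiffOn]
        exact f.contMDiff.comp_contMDiffOn (contMDiffOn_extChartAt_symm x₀)
      exact (ContinuousAlternatingMap.constOfIsEmptyLIE ℝ E ℝ (Fin 0)).contDiff.comp_contDiffOn
        h⟩

/-- The form `σ^k = σ ∧ ⋯ ∧ σ` of degree `2k`, with `σ^0 = 1`. -/
def wedgePow (σ : Form E M 2) : (k : ℕ) → Form E M (2 * k)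
  | 0 => ofFun (ContMDiffMap.const 1)
  | k + 1 => wedge (wedgePow σ k) σ

/-- The map `L_σ^k : Ω^q(M) → Ω^{q+2k}(M)`, `α ↦ α ∧ σ^k`. -/
def lefschetz (σ : Form E M 2) (k q : ℕ) : Form E M q →ₗ[ℝ] Form E M (q + 2 * k) :=
  wedgeRight q (wedgePow σ k)

/-- A symplectic form: closed and nondegenerate at every point. -/
def IsSymplectic (σ : Form E M 2) : Prop :=
  d E M 2 σ = 0 ∧
    ∀ (x : M) (v : TangentSpace 𝓘(ℝ, E) x), (∀ w, σ.1 x ![v, w] = 0) → v = 0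

/-- `σ` is exact: `σ = dη` for a `1`-form `η`. -/
def IsExact (σ : Form E M 2) : Prop := ∃ η : Form E M 1, d E M 1 η = σ

/-! Cohomology of a graded subspace `S^q ⊆ Ω^q(M)` with the exterior derivative. -/

/-- The closed forms in `S^q`. -/
def cocycles (S : ∀ q, Submodule ℝ (Form E M q)) (q : ℕ) : Submodule ℝ (Form E M q) :=
  S q ⊓ LinearMap.ker (d E M q)

/-- The image `d(S^{q-1})`, zero for `q = 0`. -/
def coboundaries (S : ∀ q, Submodule ℝ (Form E M q)) : (q : ℕ) → Submodule ℝ (Form E M q)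
  | 0 => ⊥
  | q + 1 => (S q).map (d E M q)

/-- The cohomology `ker (d : S^q → S^{q+1}) / im (d : S^{q-1} → S^q)` of a subcomplex `S` of the
de Rham complex. -/
abbrev Cohomology (S : ∀ q, Submodule ℝ (Form E M q)) (q : ℕ) : Type _ :=
  ↥(cocycles S q) ⧸ (coboundaries S q).submoduleOf (cocycles S q)

/-- The whole de Rham complex. -/
def allForms (E : Type*) [NormedAddCommGroup E] [NormedSpace ℝ E]
    (M : Type*) [TopologicalSpace M] [ChartedSpace E M] :
    ∀ q, Submodule ℝ (Form E M q) := fun _ => ⊤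

/-- The de Rham cohomology `H^q(M)`. -/
abbrev DeRham (E : Type*) [NormedAddCommGroup E] [NormedSpace ℝ E]
    (M : Type*) [TopologicalSpace M] [ChartedSpace E M] [IsManifold 𝓘(ℝ, E) ∞ M] (q : ℕ) :
    Type _ := Cohomology (allForms E M) q

/-- The Betti number `b_q(M) = dim H^q(M)`. -/
def betti (E : Type*) [NormedAddCommGroup E] [NormedSpace ℝ E]
    (M : Type*) [TopologicalSpace M] [ChartedSpace E M] [IsManifold 𝓘(ℝ, E) ∞ M] (q : ℕ) : ℕ :=
  Module.finrank ℝ (DeRham E M q)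

/-- `M` is of finite type: all its Betti numbers are finite. -/
def IsFiniteType (E : Type*) [NormedAddCommGroup E] [NormedSpace ℝ E]
    (M : Type*) [TopologicalSpace M] [ChartedSpace E M] [IsManifold 𝓘(ℝ, E) ∞ M] : Prop :=
  ∀ q, FiniteDimensional ℝ (DeRham E M q)

/-- The space of `k`-coeffective `q`-forms, `{α | α ∧ σ^k = 0}`. -/
def coeffective (σ : Form E M 2) (k q : ℕ) : Submodule ℝ (Form E M q) :=
  LinearMap.ker (lefschetz σ k q)

/-- The `k`-coeffective cohomology group `H^q_{(k)}(M)`. -/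
abbrev CoeffCohomology (σ : Form E M 2) (k q : ℕ) : Type _ := Cohomology (coeffective σ k) q

/-- The forms `dβ`, `β` a `(q-1)`-form for which `β ∧ σ^k` is closed. -/
def connectingForms (σ : Form E M 2) (k : ℕ) : (q : ℕ) → Submodule ℝ (Form E M q)
  | 0 => ⊥
  | q + 1 => (LinearMap.ker (d E M (q + 2 * k) ∘ₗ lefschetz σ k q)).map (d E M q)

/-- The image in `H^q_{(k)}(M)` of the connecting homomorphism
`f_q : H^{q-1+2k}(L_σ^k(Ω^*(M))) → H^q_{(k)}(M)`, `f_q [β ∧ σ^k] = [dβ]`, of the short exact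
sequence of complexes of `L_σ^k`. For `q = n - k + 1` the kernel of `f_q` is the image of
`H^{n-k}(M)`, so that this image is `H^{n+k}(L_σ^k(Ω^*(M))) / H^{n-k}(M)`. -/
def connectingRange (σ : Form E M 2) (k q : ℕ) : Submodule ℝ (CoeffCohomology σ k q) :=
  ((connectingForms σ k q).submoduleOf (cocycles (coeffective σ k) q)).map
    ((coboundaries (coeffective σ k) q).submoduleOf (cocycles (coeffective σ k) q)).mkQ

/-- The space `Ĥ^q(M)`, the quotient of `H^q_{(k)}(M)` by the image of the connecting
homomorphism; it is used for `q = n - k + 1`. -/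
abbrev HatCohomology (σ : Form E M 2) (k q : ℕ) : Type _ :=
  CoeffCohomology σ k q ⧸ connectingRange σ k q

/-- The `k`-coeffective number `c_q^{(k)}(M) = dim H^q_{(k)}(M)`; meaningful when this dimension
is finite. -/
def coeffNumber (σ : Form E M 2) (k q : ℕ) : ℕ := Module.finrank ℝ (CoeffCohomology σ k q)

/-- The number `ĉ_q(M) = dim Ĥ^q(M)`, for `q = n - k + 1`; meaningful when this dimension is
finite. -/
def hatNumber (σ : Form E M 2) (k q : ℕ) : ℕ := Module.finrank ℝ (HatCohomology σ k q)

/-- The Hard Lefschetz Condition on a `2n`-dimensional manifold: for `1 ≤ j ≤ n` the map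
`H^{n-j}(M) → H^{n+j}(M)`, `[α] ↦ [α ∧ σ^j]`, is surjective. Here `p = n - j`, and so
`n + j = p + 2j`. -/
def HardLefschetz (n : ℕ) (σ : Form E M 2) : Prop :=
  ∀ p j : ℕ, 1 ≤ j → p + j = n → ∀ c : DeRham E M (p + 2 * j),
    ∃ α ∈ cocycles (allForms E M) p,
      ∃ h : lefschetz σ j p α ∈ cocycles (allForms E M) (p + 2 * j),
        Submodule.Quotient.mk ⟨lefschetz σ j p α, h⟩ = c

end Forms

section Disk

/-- The open unit disk in `ℝ^{2n}`. -/
def disk (n : ℕ) : TopologicalSpace.Opens (EuclideanSpace ℝ (Fin (2 * n))) :=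
  ⟨Metric.ball 0 1, Metric.isOpen_ball⟩

/-- The coordinate function `x^i` on the disk (the indices start at `0`). -/
def coord (n : ℕ) (i : Fin (2 * n)) :
    C^∞⟮𝓘(ℝ, EuclideanSpace ℝ (Fin (2 * n))), disk n; 𝓘(ℝ, ℝ), ℝ⟯ :=
  ⟨fun x => x.1 i, (EuclideanSpace.proj (𝕜 := ℝ) i).contDiff.contMDiff.comp contMDiff_subtype_val⟩

/-- The differential `dx^i` on the disk. -/
def dx (n : ℕ) (i : Fin (2 * n)) : Form (EuclideanSpace ℝ (Fin (2 * n))) (disk n) 1 :=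
  d _ _ 0 (ofFun (coord n i))

/-- The standard symplectic form `∑_{i=1}^n dx^i ∧ dx^{n+i}` on the disk. -/
def stdForm (n : ℕ) : Form (EuclideanSpace ℝ (Fin (2 * n))) (disk n) 2 :=
  ∑ i : Fin n, wedge (dx n ⟨i, by omega⟩) (dx n ⟨n + i, by omega⟩)

end Disk

end Coeff

end

/-! Everything reduces to one algebraic fact and the long exact sequence. The algebraic fact
(`lef_surjective`) is that `L^k : Ω^p → Ω^{p+2k}` is onto for `p ≥ n - k`. So in these degrees
`L^k(Ω^*)` is the shifted de Rham complex, and the long exact sequence relates coeffective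
cohomology to the maps induced by `L^k` on de Rham cohomology. The map `H^q_{(k)} → H^q` has image
`ker (L^k : H^q → H^{q+2k})` as soon as `L^k` is onto on `(q-1)`-forms (`range_coeffToDeRham`). Its
kernel is the range of the connecting homomorphism (`ker_coeffToDeRham`), and this range is `coker
(L^k : H^{q-1} → H^{q-1+2k})` if `L^k` is also onto on `(q-2)`-forms (`connectingRangeEquiv`). Hence
`ĉ_q = dim ker` for `q ≥ n-k+1`, and `c_q = dim ker + dim coker` for `q ≥ n-k+2`.

The numerical statements follow by rank-nullity. The bounds come from `0 ≤ rank ≤ dim` of the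
target. Under the HLC both maps `L^k` are onto. If `σ = dη`, both are zero, because `α ∧ σ^k = ± d(α
∧ σ^{k-1} ∧ η)` for closed `α`. On the disk, the Poincaré lemma makes the Betti numbers in positive
degree vanish, and the upper bounds do the rest.

Surjectivity of `L^k` uses the contraction `Λ` with the bivector inverse to `σ`. The commutator `LΛ
- ΛL` is multiplication by `deg - n` (`contract_commutator`). If `Lb = 0` with `deg b = n + m`, this
makes `b, Λb, Λ²b, …` successive eigenforms of `LΛ` with positive eigenvalues, so `b` is a multiple
of `L^m Λ^m b`. A general form is corrected to one killed by `L` by induction on the source degree.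
-/

noncomputable section

namespace Coeff

/-! ### Signed sums over permutations and associativity of the wedge product. -/

section Wedge

/-- The signed sum of a function of `m` vectors over all permutations of its arguments. -/
def signedSum {V : Type*} {m : ℕ} (T : (Fin m → V) → ℝ) (v : Fin m → V) : ℝ :=
  ∑ τ : Equiv.Perm (Fin m), ((Equiv.Perm.sign τ : ℤ) : ℝ) * T (v ∘ τ)

theorem sign_mul_self_real {m : ℕ} (τ : Equiv.Perm (Fin m)) :
    ((Equiv.Perm.sign τ : ℤ) : ℝ) * ((Equiv.Perm.sign τ : ℤ) : ℝ) = 1 := by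
  rcases Int.units_eq_one_or (Equiv.Perm.sign τ) with h | h <;> simp [h]

theorem signedSum_comp_perm {V : Type*} {m : ℕ} (T : (Fin m → V) → ℝ) (ρ : Equiv.Perm (Fin m))
    (v : Fin m → V) :
    signedSum (fun w => T (w ∘ ρ)) v = ((Equiv.Perm.sign ρ : ℤ) : ℝ) * signedSum T v := by
  unfold signedSum
  rw [← Equiv.sum_comp (Equiv.mulRight ρ)
    (fun τ => ((Equiv.Perm.sign τ : ℤ) : ℝ) * T (v ∘ τ)), Finset.mul_sum]
  refine (Finset.sum_congr rfl fun τ _ => ?_)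
  have hs := sign_mul_self_real ρ
  have h : T (v ∘ (Equiv.mulRight ρ τ)) = T ((v ∘ τ) ∘ ρ) := rfl
  rw [h, Equiv.coe_mulRight, Equiv.Perm.sign_mul]
  push_cast
  linear_combination (-((Equiv.Perm.sign τ : ℤ) : ℝ) * T ((v ∘ τ) ∘ ρ)) * hs

theorem signedSum_const_mul {V : Type*} {m : ℕ} (c : ℝ) (T : (Fin m → V) → ℝ) (v : Fin m → V) :
    signedSum (fun w => c * T w) v = c * signedSum T v := by
  unfold signedSum
  rw [Finset.mul_sum]
  exact Finset.sum_congr rfl fun τ _ => by ring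

theorem signedSum_sum {V ι : Type*} {m : ℕ} (s : Finset ι) (T : ι → (Fin m → V) → ℝ)
    (v : Fin m → V) :
    signedSum (fun w => ∑ i ∈ s, T i w) v = ∑ i ∈ s, signedSum (T i) v := by
  unfold signedSum
  rw [Finset.sum_comm]
  exact Finset.sum_congr rfl fun τ _ => Finset.mul_sum _ _ _

variable {E : Type*} [AddCommGroup E] [Module ℝ E] [TopologicalSpace E]

theorem signedSum_alternating {m : ℕ} (G : E [⋀^Fin m]→L[ℝ] ℝ) (v : Fin m → E) :
    signedSum G v = (m.factorial : ℝ) * G v := by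
  unfold signedSum
  have h : ∀ τ : Equiv.Perm (Fin m), ((Equiv.Perm.sign τ : ℤ) : ℝ) * G (v ∘ τ) = G v := by
    intro τ
    have h1 : G (v ∘ τ) = Equiv.Perm.sign τ • G v := G.toAlternatingMap.map_perm v τ
    rw [h1, Units.smul_def, zsmul_eq_mul, ← mul_assoc, sign_mul_self_real, one_mul]
  rw [Finset.sum_congr rfl fun τ _ => h τ, Finset.sum_const, Finset.card_univ,
    Fintype.card_perm, Fintype.card_fin, nsmul_eq_mul]

theorem wedgeAlt_eq_signedSum {p q : ℕ} (α : E [⋀^Fin p]→L[ℝ] ℝ) (β : E [⋀^Fin q]→L[ℝ] ℝ)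
    (v : Fin (p + q) → E) :
    wedgeAlt α β v = ((p.factorial : ℝ) * (q.factorial : ℝ))⁻¹ *
      signedSum (fun w => α (fun i => w (Fin.castAdd q i)) * β (fun i => w (Fin.natAdd p i))) v :=
  wedgeAlt_apply α β v

/-- A permutation of the last `q` indices. -/
def permRight (p : ℕ) {q : ℕ} (ρ : Equiv.Perm (Fin q)) : Equiv.Perm (Fin (p + q)) :=
  finSumFinEquiv.permCongr (Equiv.Perm.sumCongr 1 ρ)

theorem permRight_castAdd (p : ℕ) {q : ℕ} (ρ : Equiv.Perm (Fin q)) (i : Fin p) :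
    permRight p ρ (Fin.castAdd q i) = Fin.castAdd q i := by
  simp [permRight, Equiv.permCongr_apply]

theorem permRight_natAdd (p : ℕ) {q : ℕ} (ρ : Equiv.Perm (Fin q)) (i : Fin q) :
    permRight p ρ (Fin.natAdd p i) = Fin.natAdd p (ρ i) := by
  simp [permRight, Equiv.permCongr_apply]

theorem sign_permRight (p : ℕ) {q : ℕ} (ρ : Equiv.Perm (Fin q)) :
    Equiv.Perm.sign (permRight p ρ) = Equiv.Perm.sign ρ := by
  simp [permRight, Equiv.Perm.sign_permCongr, Equiv.Perm.sign_sumCongr]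

/-- A permutation of the first `p` indices. -/
def permLeft {p : ℕ} (q : ℕ) (ρ : Equiv.Perm (Fin p)) : Equiv.Perm (Fin (p + q)) :=
  finSumFinEquiv.permCongr (Equiv.Perm.sumCongr ρ 1)

theorem permLeft_castAdd {p : ℕ} (q : ℕ) (ρ : Equiv.Perm (Fin p)) (i : Fin p) :
    permLeft q ρ (Fin.castAdd q i) = Fin.castAdd q (ρ i) := by
  simp [permLeft, Equiv.permCongr_apply]

theorem permLeft_natAdd {p : ℕ} (q : ℕ) (ρ : Equiv.Perm (Fin p)) (i : Fin q) :
    permLeft q ρ (Fin.natAdd p i) = Fin.natAdd p i := by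
  simp [permLeft, Equiv.permCongr_apply]

theorem sign_permLeft {p : ℕ} (q : ℕ) (ρ : Equiv.Perm (Fin p)) :
    Equiv.Perm.sign (permLeft q ρ) = Equiv.Perm.sign ρ := by
  simp [permLeft, Equiv.Perm.sign_permCongr, Equiv.Perm.sign_sumCongr]

/-- A permutation of the last `q` slots extends to all slots with the same sign, so the outer sum
absorbs it. The inner antisymmetrization therefore only contributes `q!` equal terms. -/
theorem signedSum_mul_signedSum {V : Type*} {p q : ℕ} (A : (Fin p → V) → ℝ) (B : (Fin q → V) → ℝ)
    (v : Fin (p + q) → V) :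
    signedSum (fun w => A (fun i => w (Fin.castAdd q i)) *
      signedSum B (fun i => w (Fin.natAdd p i))) v =
    (q.factorial : ℝ) * signedSum (fun w => A (fun i => w (Fin.castAdd q i)) *
      B (fun i => w (Fin.natAdd p i))) v := by
  have h : ∀ ρ : Equiv.Perm (Fin q),
      signedSum (fun w : Fin (p + q) → V => ((Equiv.Perm.sign ρ : ℤ) : ℝ) *
        (A (fun i => w (Fin.castAdd q i)) * B ((fun i => w (Fin.natAdd p i)) ∘ ρ))) v =
      signedSum (fun w => A (fun i => w (Fin.castAdd q i)) *
        B (fun i => w (Fin.natAdd p i))) v := by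
    intro ρ
    have h1 := signedSum_comp_perm (fun w : Fin (p + q) → V =>
      A (fun i => w (Fin.castAdd q i)) * B (fun i => w (Fin.natAdd p i))) (permRight p ρ) v
    simp only [Function.comp_apply, permRight_castAdd, permRight_natAdd, sign_permRight] at h1
    rw [signedSum_const_mul]
    refine (congrArg _ h1).trans ?_
    rw [← mul_assoc, sign_mul_self_real, one_mul]
  calc _ = signedSum (fun w => ∑ ρ : Equiv.Perm (Fin q), ((Equiv.Perm.sign ρ : ℤ) : ℝ) *
        (A (fun i => w (Fin.castAdd q i)) * B ((fun i => w (Fin.natAdd p i)) ∘ ρ))) v := by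
        congr 1
        funext w
        rw [signedSum, Finset.mul_sum]
        exact Finset.sum_congr rfl fun ρ _ => by ring
    _ = _ := by
        rw [signedSum_sum, Finset.sum_congr rfl fun ρ _ => h ρ, Finset.sum_const,
          Finset.card_univ, Fintype.card_perm, Fintype.card_fin, nsmul_eq_mul]

theorem signedSum_signedSum_mul {V : Type*} {p q : ℕ} (A : (Fin p → V) → ℝ) (B : (Fin q → V) → ℝ)
    (v : Fin (p + q) → V) :
    signedSum (fun w => signedSum A (fun i => w (Fin.castAdd q i)) *
      B (fun i => w (Fin.natAdd p i))) v =
    (p.factorial : ℝ) * signedSum (fun w => A (fun i => w (Fin.castAdd q i)) *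
      B (fun i => w (Fin.natAdd p i))) v := by
  have h : ∀ ρ : Equiv.Perm (Fin p),
      signedSum (fun w : Fin (p + q) → V => ((Equiv.Perm.sign ρ : ℤ) : ℝ) *
        (A ((fun i => w (Fin.castAdd q i)) ∘ ρ) * B (fun i => w (Fin.natAdd p i)))) v =
      signedSum (fun w => A (fun i => w (Fin.castAdd q i)) *
        B (fun i => w (Fin.natAdd p i))) v := by
    intro ρ
    have h1 := signedSum_comp_perm (fun w : Fin (p + q) → V =>
      A (fun i => w (Fin.castAdd q i)) * B (fun i => w (Fin.natAdd p i))) (permLeft q ρ) v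
    simp only [Function.comp_apply, permLeft_castAdd, permLeft_natAdd, sign_permLeft] at h1
    rw [signedSum_const_mul]
    refine (congrArg _ h1).trans ?_
    rw [← mul_assoc, sign_mul_self_real, one_mul]
  calc _ = signedSum (fun w => ∑ ρ : Equiv.Perm (Fin p), ((Equiv.Perm.sign ρ : ℤ) : ℝ) *
        (A ((fun i => w (Fin.castAdd q i)) ∘ ρ) * B (fun i => w (Fin.natAdd p i)))) v := by
        congr 1
        funext w
        rw [signedSum, Finset.sum_mul]
        exact Finset.sum_congr rfl fun ρ _ => by ring
    _ = _ := by
        rw [signedSum_sum, Finset.sum_congr rfl fun ρ _ => h ρ, Finset.sum_const,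
          Finset.card_univ, Fintype.card_perm, Fintype.card_fin, nsmul_eq_mul]

theorem signedSum_cast {V : Type*} {m m' : ℕ} (h : m = m') (T : (Fin m → V) → ℝ)
    (v : Fin m' → V) :
    signedSum (fun w => T (w ∘ Fin.cast h)) v = signedSum T (v ∘ Fin.cast h) := by
  subst h; rfl

/-- Associativity of the wedge product. -/
theorem wedgeAlt_assoc {p q r : ℕ} (α : E [⋀^Fin p]→L[ℝ] ℝ) (β : E [⋀^Fin q]→L[ℝ] ℝ)
    (γ : E [⋀^Fin r]→L[ℝ] ℝ) (v : Fin (p + q + r) → E) :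
    wedgeAlt (wedgeAlt α β) γ v =
      wedgeAlt α (wedgeAlt β γ) (v ∘ Fin.cast (add_assoc p q r).symm) := by
  have hp : (p.factorial : ℝ) ≠ 0 := by exact_mod_cast p.factorial_ne_zero
  have hq : (q.factorial : ℝ) ≠ 0 := by exact_mod_cast q.factorial_ne_zero
  have hr : (r.factorial : ℝ) ≠ 0 := by exact_mod_cast r.factorial_ne_zero
  have hpq : ((p + q).factorial : ℝ) ≠ 0 := by exact_mod_cast (p + q).factorial_ne_zero
  have hqr : ((q + r).factorial : ℝ) ≠ 0 := by exact_mod_cast (q + r).factorial_ne_zero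
  -- Both sides become the signed sum of `α · β · γ` over all slots; the factors `(p+q)!` and
  -- `(q+r)!` from the inner antisymmetrizations cancel against the normalizations of the outer
  -- products.
  have hL := signedSum_signedSum_mul (V := E) (fun w : Fin (p + q) → E =>
    α (fun i => w (Fin.castAdd q i)) * β (fun i => w (Fin.natAdd p i))) γ v
  have hR := signedSum_mul_signedSum (V := E) (α : (Fin p → E) → ℝ)
    (fun w : Fin (q + r) → E =>
      β (fun i => w (Fin.castAdd r i)) * γ (fun i => w (Fin.natAdd q i)))
    (v ∘ Fin.cast (add_assoc p q r).symm)
  rw [wedgeAlt_eq_signedSum, wedgeAlt_eq_signedSum]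
  simp only [wedgeAlt_eq_signedSum α β, wedgeAlt_eq_signedSum β γ, mul_assoc,
    mul_left_comm (α _)]
  rw [signedSum_const_mul, signedSum_const_mul, hL, hR]
  rw [← signedSum_cast (add_assoc p q r).symm]
  have hT : (fun w : Fin (p + q + r) → E =>
      α (fun i => w (Fin.castAdd r (Fin.castAdd q i))) *
        β (fun i => w (Fin.castAdd r (Fin.natAdd p i))) * γ (fun i => w (Fin.natAdd (p + q) i))) =
      fun w : Fin (p + q + r) → E =>
        α (fun i => (w ∘ Fin.cast (add_assoc p q r).symm) (Fin.castAdd (q + r) i)) *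
          (β (fun i => (w ∘ Fin.cast (add_assoc p q r).symm) (Fin.natAdd p (Fin.castAdd r i))) *
          γ (fun i => (w ∘ Fin.cast (add_assoc p q r).symm) (Fin.natAdd p (Fin.natAdd q i)))) := by
    funext w
    rw [mul_assoc]
    have : ∀ i : Fin r, Fin.natAdd (p + q) i =
      Fin.cast (add_assoc p q r).symm (Fin.natAdd p (Fin.natAdd q i)) := fun i =>
        Fin.ext (by simp [add_assoc])
    simp only [this]
    rfl
  rw [hT]
  field_simp

end Wedge

/-! ### Products with `1`-forms. -/

section OneForms

variable {E : Type*} [NormedAddCommGroup E] [NormedSpace ℝ E]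

/-- A continuous linear functional, as an alternating `1`-form. -/
def oneForm (ξ : E →L[ℝ] ℝ) : E [⋀^Fin 1]→L[ℝ] ℝ :=
  ContinuousAlternatingMap.ofSubsingleton ℝ E ℝ (0 : Fin 1) ξ

@[simp]
theorem oneForm_apply (ξ : E →L[ℝ] ℝ) (v : Fin 1 → E) : oneForm ξ v = ξ (v 0) := rfl

theorem eq_oneForm (η : E [⋀^Fin 1]→L[ℝ] ℝ) :
    η = oneForm ((ContinuousAlternatingMap.ofSubsingleton ℝ E ℝ (0 : Fin 1)).symm η) :=
  ((ContinuousAlternatingMap.ofSubsingleton ℝ E ℝ (0 : Fin 1)).apply_symm_apply η).symm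

/-- The wedge product with a `1`-form on the right. -/
theorem wedgeAlt_oneForm {p : ℕ} (α : E [⋀^Fin p]→L[ℝ] ℝ) (ξ : E →L[ℝ] ℝ) :
    wedgeAlt α (oneForm ξ) =
      (-1 : ℝ) ^ p • ContinuousAlternatingMap.alternatizeUncurryFin (ξ.smulRight α) := by
  ext v
  set G := ContinuousAlternatingMap.alternatizeUncurryFin (ξ.smulRight α) with hG
  set T : (Fin (p + 1) → E) → ℝ :=
    fun w => α (fun i => w (Fin.castAdd 1 i)) * oneForm ξ (fun i => w (Fin.natAdd p i)) with hT
  have h1 : signedSum G v = ((p + 1).factorial : ℝ) * G v := signedSum_alternating G v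
  -- The `i`-th term of the alternating sum `G` is `T` after the permutation that puts `v i` last
  -- and keeps the order of the others. Its sign is `(-1)^p (-1)^i`, which cancels the sign `(-1)^i`
  -- in `G`, so all `p + 1` terms contribute equally.
  have h2 : signedSum G v = ∑ i : Fin (p + 1), (-1 : ℝ) ^ p * signedSum T v := by
    have : (G : (Fin (p + 1) → E) → ℝ) = fun w => ∑ i : Fin (p + 1),
        (-1 : ℝ) ^ (i : ℕ) * T (w ∘ ((finRotate (p + 1)).trans (Fin.cycleRange i).symm)) := by
      funext w
      rw [hG, ContinuousAlternatingMap.alternatizeUncurryFin_apply]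
      refine Finset.sum_congr rfl fun i _ => ?_
      have e1 : ∀ j : Fin p, (finRotate (p + 1)) (Fin.castAdd 1 j) = j.succ := fun j => by
        have := finRotate_of_lt (n := p) (k := j) j.2
        exact this
      have e2 : (finRotate (p + 1)) (Fin.natAdd p 0) = 0 := finRotate_last
      simp only [hT, Function.comp_apply, Equiv.trans_apply, e1, oneForm_apply, e2,
        Fin.cycleRange_symm_zero, Fin.cycleRange_symm_succ]
      simp only [ContinuousLinearMap.smulRight_apply, ContinuousAlternatingMap.smul_apply,
        smul_eq_mul, zsmul_eq_mul, Int.cast_pow, Int.cast_neg, Int.cast_one, mul_comm (α _)]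
      rfl
    rw [this, signedSum_sum]
    refine Finset.sum_congr rfl fun i _ => ?_
    rw [signedSum_const_mul, signedSum_comp_perm T
      ((finRotate (p + 1)).trans (Fin.cycleRange i).symm), Equiv.Perm.sign_trans, sign_finRotate,
      Equiv.Perm.sign_symm, Fin.sign_cycleRange]
    push_cast
    rw [← mul_assoc, ← mul_assoc, ← pow_add, Even.neg_one_pow ⟨_, rfl⟩, one_mul]
  have hp : (p.factorial : ℝ) ≠ 0 := by exact_mod_cast p.factorial_ne_zero
  have hp1 : (p + 1 : ℝ) ≠ 0 := by positivity
  rw [h1, Finset.sum_const, Finset.card_univ, Fintype.card_fin, nsmul_eq_mul,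
    Nat.factorial_succ] at h2
  push_cast at h2
  rw [wedgeAlt_eq_signedSum, ContinuousAlternatingMap.smul_apply, smul_eq_mul]
  change _ * signedSum T v = _
  have h3 : (p.factorial : ℝ) * G v = (-1) ^ p * signedSum T v :=
    mul_left_cancel₀ hp1 (by linear_combination h2)
  have hsq : ((-1 : ℝ) ^ p) * (-1) ^ p = 1 := by
    rw [← pow_add, Even.neg_one_pow ⟨_, rfl⟩]
  simp only [Nat.factorial_one, Nat.cast_one, mul_one]
  field_simp
  linear_combination (-(-1 : ℝ) ^ p) * h3 - signedSum T v * hsq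

theorem wedgeAlt_oneForm_apply {p : ℕ} (α : E [⋀^Fin p]→L[ℝ] ℝ) (ξ : E →L[ℝ] ℝ)
    (v : Fin (p + 1) → E) :
    wedgeAlt α (oneForm ξ) v =
      (-1 : ℝ) ^ p * ∑ i : Fin (p + 1), (-1 : ℝ) ^ (i : ℕ) * (ξ (v i) * α (i.removeNth v)) := by
  rw [wedgeAlt_oneForm, ContinuousAlternatingMap.smul_apply,
    ContinuousAlternatingMap.alternatizeUncurryFin_apply, smul_eq_mul]
  simp

end OneForms

/-! ### Linearity, anticommutation and contraction of products with `1`-forms. -/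

section OneForms

variable {E : Type*} [NormedAddCommGroup E] [NormedSpace ℝ E]

theorem wedgeAlt_neg_right {p q : ℕ} (α : E [⋀^Fin p]→L[ℝ] ℝ) (β : E [⋀^Fin q]→L[ℝ] ℝ) :
    wedgeAlt α (-β) = -wedgeAlt α β :=
  map_neg (wedgeCLM E p q α) β

theorem wedgeAlt_neg_left {p q : ℕ} (α : E [⋀^Fin p]→L[ℝ] ℝ) (β : E [⋀^Fin q]→L[ℝ] ℝ) :
    wedgeAlt (-α) β = -wedgeAlt α β :=
  map_neg ((wedgeCLM E p q).flip β) α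

theorem wedgeAlt_sum_left {ι : Type*} {p q : ℕ} (s : Finset ι) (α : ι → E [⋀^Fin p]→L[ℝ] ℝ)
    (β : E [⋀^Fin q]→L[ℝ] ℝ) :
    wedgeAlt (∑ i ∈ s, α i) β = ∑ i ∈ s, wedgeAlt (α i) β :=
  map_sum ((wedgeCLM E p q).flip β) α s

theorem wedgeAlt_sum_right {ι : Type*} {p q : ℕ} (s : Finset ι) (α : E [⋀^Fin p]→L[ℝ] ℝ)
    (β : ι → E [⋀^Fin q]→L[ℝ] ℝ) :
    wedgeAlt α (∑ i ∈ s, β i) = ∑ i ∈ s, wedgeAlt α (β i) :=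
  map_sum (wedgeCLM E p q α) β s

/-- Contraction of a wedge product with a `1`-form. -/
theorem curryLeft_wedgeAlt_oneForm {p : ℕ} (α : E [⋀^Fin (p + 1)]→L[ℝ] ℝ) (ξ : E →L[ℝ] ℝ)
    (v : E) :
    (wedgeAlt α (oneForm ξ)).curryLeft v =
      wedgeAlt (α.curryLeft v) (oneForm ξ) + ((-1 : ℝ) ^ (p + 1) * ξ v) • α := by
  ext w
  have h : ∀ i : Fin (p + 1), i.succ.removeNth (Matrix.vecCons v w) =
      Matrix.vecCons v (i.removeNth w) := by
    intro i
    funext j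
    refine Fin.cases ?_ (fun j => ?_) j
    · simp [Fin.removeNth]
    · simp [Fin.removeNth, Fin.succ_succAbove_succ]
  have h0 : (0 : Fin (p + 2)).removeNth (Matrix.vecCons v w) = w := by
    funext j
    simp [Fin.removeNth]
  rw [ContinuousAlternatingMap.curryLeft_apply_apply, ContinuousAlternatingMap.add_apply,
    ContinuousAlternatingMap.smul_apply]
  refine (wedgeAlt_oneForm_apply α ξ (Matrix.vecCons v w)).trans ?_
  -- In the zeroth summand `ξ` takes `v`, which gives the multiple of `α`; in the others `v` stays
  -- in the first slot of `α`.
  rw [wedgeAlt_oneForm_apply, Fin.sum_univ_succ]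
  simp only [h, h0, Matrix.cons_val_zero, Matrix.cons_val_succ, Fin.val_zero, Fin.val_succ,
    ContinuousAlternatingMap.curryLeft_apply_apply, pow_succ, smul_eq_mul, mul_neg, mul_one,
    neg_mul, Finset.sum_neg_distrib, pow_zero, one_mul]
  ring

theorem wedgeAlt_oneForm_oneForm_apply (ξ η : E →L[ℝ] ℝ) (v : Fin 2 → E) :
    wedgeAlt (oneForm ξ) (oneForm η) v = ξ (v 0) * η (v 1) - η (v 0) * ξ (v 1) := by
  refine (wedgeAlt_oneForm_apply (oneForm ξ) η v).trans ?_
  rw [Fin.sum_univ_two]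
  simp [Fin.removeNth, Fin.tail]
  ring

theorem wedgeAlt_oneForm_comm (ξ η : E →L[ℝ] ℝ) :
    wedgeAlt (oneForm ξ) (oneForm η) = -wedgeAlt (oneForm η) (oneForm ξ) := by
  ext v
  rw [ContinuousAlternatingMap.neg_apply]
  refine (wedgeAlt_oneForm_oneForm_apply ξ η v).trans ?_
  rw [show wedgeAlt (oneForm η) (oneForm ξ) v = _ from wedgeAlt_oneForm_oneForm_apply η ξ v]
  ring

/-- With a last factor of degree `1`, the degrees `p + q + 1` and `p + (q + 1)` agree
definitionally, so associativity is an honest equality without a cast. The same holds for a last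
factor of degree `2`. -/
theorem wedgeAlt_wedgeAlt_oneForm {p q : ℕ} (α : E [⋀^Fin p]→L[ℝ] ℝ) (β : E [⋀^Fin q]→L[ℝ] ℝ)
    (ξ : E →L[ℝ] ℝ) :
    wedgeAlt (wedgeAlt α β) (oneForm ξ) = wedgeAlt α (wedgeAlt β (oneForm ξ)) := by
  ext v
  exact wedgeAlt_assoc α β (oneForm ξ) v

theorem wedgeAlt_wedgeAlt_two {p q : ℕ} (α : E [⋀^Fin p]→L[ℝ] ℝ) (β : E [⋀^Fin q]→L[ℝ] ℝ)
    (σ : E [⋀^Fin 2]→L[ℝ] ℝ) :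
    wedgeAlt (wedgeAlt α β) σ = wedgeAlt α (wedgeAlt β σ) := by
  ext v
  exact wedgeAlt_assoc α β σ v

theorem wedgeAlt_oneForm_anticomm {p : ℕ} (α : E [⋀^Fin p]→L[ℝ] ℝ) (ξ η : E →L[ℝ] ℝ) :
    wedgeAlt (wedgeAlt α (oneForm ξ)) (oneForm η) =
      -wedgeAlt (wedgeAlt α (oneForm η)) (oneForm ξ) := by
  rw [wedgeAlt_wedgeAlt_oneForm, wedgeAlt_wedgeAlt_oneForm, wedgeAlt_oneForm_comm,
    wedgeAlt_neg_right]

theorem wedgeAlt_two_eq_sum {m : ℕ} {ξ η : Fin m → E →L[ℝ] ℝ} {σ : E [⋀^Fin 2]→L[ℝ] ℝ}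
    (h : σ = ∑ i, wedgeAlt (oneForm (ξ i)) (oneForm (η i))) {p : ℕ} (α : E [⋀^Fin p]→L[ℝ] ℝ) :
    wedgeAlt α σ = ∑ i, wedgeAlt (wedgeAlt α (oneForm (ξ i))) (oneForm (η i)) := by
  rw [h]
  refine (wedgeAlt_sum_right _ _ _).trans ?_
  exact Finset.sum_congr rfl fun i _ => (wedgeAlt_wedgeAlt_oneForm _ _ _).symm

theorem oneForm_curryLeft_two (σ : E [⋀^Fin 2]→L[ℝ] ℝ) {m : ℕ} {ξ η : Fin m → E →L[ℝ] ℝ}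
    (h : σ = ∑ i, wedgeAlt (oneForm (ξ i)) (oneForm (η i))) (v : E) :
    σ.curryLeft v = oneForm (∑ i, (ξ i v • η i - η i v • ξ i)) := by
  ext w
  rw [h, ContinuousAlternatingMap.curryLeft_apply_apply, oneForm_apply]
  simp only [ContinuousAlternatingMap.sum_apply, sum_apply]
  refine Finset.sum_congr rfl fun i _ => ?_
  refine (wedgeAlt_oneForm_oneForm_apply _ _ _).trans ?_
  simp

end OneForms

/-! ### Basis expansions and the pointwise Leibniz rules. -/

section FiniteDimensional

variable {E : Type*} [NormedAddCommGroup E] [NormedSpace ℝ E] [FiniteDimensional ℝ E]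
  {ι : Type*} [Fintype ι] (e : Module.Basis ι ℝ E)

/-- The coordinate functionals of a basis. -/
def dual (a : ι) : E →L[ℝ] ℝ := LinearMap.toContinuousLinearMap (e.coord a)

theorem sum_dual_smul (u : E) : ∑ a, dual e a u • e a = u := e.sum_repr u

theorem sum_apply_smul_dual (ξ : E →L[ℝ] ℝ) : ∑ a, ξ (e a) • dual e a = ξ := by
  ext u
  conv_rhs => rw [← sum_dual_smul e u, map_sum]
  simp [mul_comm]

/-- Expand `A` in the dual basis and apply `wedgeAlt_oneForm` to each term. When `A` is the
derivative of a form, this is `dα = ∑ e^a ∧ ∂_a α` with `e^a` moved to the right, and it turns each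
Leibniz rule into associativity and commutation with `1`-forms. -/
theorem alternatizeUncurryFin_eq_sum {p : ℕ} (A : E →L[ℝ] E [⋀^Fin p]→L[ℝ] ℝ) :
    ContinuousAlternatingMap.alternatizeUncurryFin A =
      (-1 : ℝ) ^ p • ∑ a, wedgeAlt (A (e a)) (oneForm (dual e a)) := by
  have hA : A = ∑ a, (dual e a).smulRight (A (e a)) := by
    ext1 u
    conv_lhs => rw [← sum_dual_smul e u, map_sum]
    simp
  conv_lhs => rw [hA, ← ContinuousAlternatingMap.alternatizeUncurryFinCLM_apply, map_sum]
  rw [Finset.smul_sum]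
  refine Finset.sum_congr rfl fun a _ => ?_
  rw [wedgeAlt_oneForm, smul_smul, ← pow_add, Even.neg_one_pow ⟨_, rfl⟩, one_smul]
  rfl

/-- Euler's identity. -/
theorem sum_wedgeAlt_curryLeft {p : ℕ} (α : E [⋀^Fin (p + 1)]→L[ℝ] ℝ) :
    ∑ a, wedgeAlt (α.curryLeft (e a)) (oneForm (dual e a)) = ((-1 : ℝ) ^ p * (p + 1)) • α := by
  have h := alternatizeUncurryFin_eq_sum e α.curryLeft
  rw [ContinuousAlternatingMap.alternatizeUncurryFin_curryLeft] at h
  have h2 := congrArg (fun β => (-1 : ℝ) ^ p • β) h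
  simp only [smul_smul, ← pow_add] at h2
  rw [Even.neg_one_pow ⟨_, rfl⟩, one_smul] at h2
  rw [← h2, mul_smul, ← Nat.cast_smul_eq_nsmul ℝ]
  push_cast
  rfl

/-- A `2`-form is a finite sum of products of `1`-forms. -/
theorem exists_sum_wedge_oneForm (σ : E [⋀^Fin 2]→L[ℝ] ℝ) :
    ∃ (m : ℕ) (ξ η : Fin m → E →L[ℝ] ℝ), σ = ∑ i, wedgeAlt (oneForm (ξ i)) (oneForm (η i)) := by
  let b := Module.finBasis ℝ E
  -- The constant `-1/2` inverts the factor `-2` in Euler's identity for a `2`-form.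
  refine ⟨_, fun a => (ContinuousAlternatingMap.ofSubsingleton ℝ E ℝ
    (0 : Fin 1)).symm ((-(1 / 2 : ℝ)) • σ.curryLeft (b a)), fun a => dual b a, ?_⟩
  have h := sum_wedgeAlt_curryLeft b σ
  have h2 : σ = (-(1 / 2 : ℝ)) • ((-1 : ℝ) ^ 1 * ((1 : ℕ) + 1)) • σ := by
    rw [smul_smul]; norm_num
  refine h2.trans ?_
  rw [← h, Finset.smul_sum]
  refine Finset.sum_congr rfl fun a _ => ?_
  rw [← wedgeAlt_smul_left]
  exact congrArg (fun t => wedgeAlt t (oneForm (dual b a))) (eq_oneForm _)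

/-- On each product of two `1`-forms in `σ`, moving `ξ` across costs two signs. -/
theorem wedgeAlt_two_oneForm {p : ℕ} (α : E [⋀^Fin p]→L[ℝ] ℝ) (σ : E [⋀^Fin 2]→L[ℝ] ℝ)
    (ξ : E →L[ℝ] ℝ) :
    wedgeAlt (wedgeAlt α σ) (oneForm ξ) = wedgeAlt (wedgeAlt α (oneForm ξ)) σ := by
  obtain ⟨m, a, b, h⟩ := exists_sum_wedge_oneForm σ
  rw [wedgeAlt_two_eq_sum h, wedgeAlt_two_eq_sum h]
  refine (wedgeAlt_sum_left _ _ _).trans ?_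
  refine Finset.sum_congr rfl fun i _ => ?_
  refine (wedgeAlt_oneForm_anticomm (wedgeAlt α (oneForm (a i))) (b i) ξ).trans ?_
  rw [wedgeAlt_oneForm_anticomm α (a i) ξ, wedgeAlt_neg_left, neg_neg]

/-- Contraction of a wedge product with a `2`-form. -/
theorem curryLeft_wedgeAlt_two {p : ℕ} (α : E [⋀^Fin (p + 1)]→L[ℝ] ℝ) (σ : E [⋀^Fin 2]→L[ℝ] ℝ)
    (v : E) :
    (wedgeAlt α σ).curryLeft v =
      wedgeAlt (α.curryLeft v) σ + (-1 : ℝ) ^ (p + 1) • wedgeAlt α (σ.curryLeft v) := by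
  obtain ⟨m, ξ, η, h⟩ := exists_sum_wedge_oneForm σ
  rw [wedgeAlt_two_eq_sum h, wedgeAlt_two_eq_sum h, oneForm_curryLeft_two σ h]
  have h1 : (∑ i, wedgeAlt (wedgeAlt α (oneForm (ξ i))) (oneForm (η i))).curryLeft v =
      ∑ i, (wedgeAlt (wedgeAlt α (oneForm (ξ i))) (oneForm (η i))).curryLeft v := by
    ext w
    simp only [ContinuousAlternatingMap.curryLeft_apply_apply, ContinuousAlternatingMap.sum_apply]
  have h2 : wedgeAlt α (oneForm (∑ i, (ξ i v • η i - η i v • ξ i))) =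
      ∑ i, (ξ i v • wedgeAlt α (oneForm (η i)) - η i v • wedgeAlt α (oneForm (ξ i))) := by
    have : oneForm (∑ i, (ξ i v • η i - η i v • ξ i)) =
        ∑ i, (ξ i v • oneForm (η i) - η i v • oneForm (ξ i)) := by
      ext w
      simp
    rw [this, wedgeAlt_sum_right]
    refine Finset.sum_congr rfl fun i _ => ?_
    rw [sub_eq_add_neg, wedgeAlt_add_right, wedgeAlt_neg_right, wedgeAlt_smul_right,
      wedgeAlt_smul_right, sub_eq_add_neg]
  refine h1.trans ?_
  rw [h2, Finset.smul_sum, ← Finset.sum_add_distrib]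
  refine Finset.sum_congr rfl fun i _ => ?_
  refine (curryLeft_wedgeAlt_oneForm _ _ _).trans ?_
  rw [curryLeft_wedgeAlt_oneForm, wedgeAlt_add_left, wedgeAlt_smul_left, pow_succ (-1 : ℝ) (p + 1)]
  module

/-- Leibniz rule, differentiating the second factor. -/
theorem alternatizeUncurryFin_wedge_right {p q : ℕ} (α : E [⋀^Fin p]→L[ℝ] ℝ)
    (B : E →L[ℝ] E [⋀^Fin q]→L[ℝ] ℝ) :
    ContinuousAlternatingMap.alternatizeUncurryFin (wedgeCLM E p q α ∘L B) =
      (-1 : ℝ) ^ p • wedgeAlt α (ContinuousAlternatingMap.alternatizeUncurryFin B) := by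
  let b := Module.finBasis ℝ E
  rw [alternatizeUncurryFin_eq_sum b, alternatizeUncurryFin_eq_sum b B, wedgeAlt_smul_right,
    wedgeAlt_sum_right, smul_smul, ← pow_add]
  congr 1
  exact Finset.sum_congr rfl fun a _ => wedgeAlt_wedgeAlt_oneForm _ _ _

/-- Leibniz rule for the product with a `2`-form, differentiating the first factor. -/
theorem alternatizeUncurryFin_wedge_two {p : ℕ} (A : E →L[ℝ] E [⋀^Fin p]→L[ℝ] ℝ)
    (σ : E [⋀^Fin 2]→L[ℝ] ℝ) :
    ContinuousAlternatingMap.alternatizeUncurryFin ((wedgeCLM E p 2).flip σ ∘L A) =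
      wedgeAlt (ContinuousAlternatingMap.alternatizeUncurryFin A) σ := by
  let b := Module.finBasis ℝ E
  rw [alternatizeUncurryFin_eq_sum b, alternatizeUncurryFin_eq_sum b A, wedgeAlt_smul_left,
    wedgeAlt_sum_left, pow_add, even_two.neg_one_pow, mul_one]
  congr 1
  exact Finset.sum_congr rfl fun a _ => wedgeAlt_two_oneForm _ _ _

/-- Leibniz rule for the product with a `1`-form, differentiating the first factor. -/
theorem alternatizeUncurryFin_wedge_one {p : ℕ} (A : E →L[ℝ] E [⋀^Fin p]→L[ℝ] ℝ)
    (η : E [⋀^Fin 1]→L[ℝ] ℝ) :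
    ContinuousAlternatingMap.alternatizeUncurryFin ((wedgeCLM E p 1).flip η ∘L A) =
      wedgeAlt (ContinuousAlternatingMap.alternatizeUncurryFin A) η := by
  let b := Module.finBasis ℝ E
  have key : ∑ a, wedgeAlt (((wedgeCLM E p 1).flip η ∘L A) (b a)) (oneForm (dual b a)) =
      -∑ a, wedgeAlt (wedgeAlt (A (b a)) (oneForm (dual b a))) η := by
    rw [← Finset.sum_neg_distrib]
    refine Finset.sum_congr rfl fun a _ => ?_
    rw [eq_oneForm η]
    exact wedgeAlt_oneForm_anticomm _ _ _
  rw [alternatizeUncurryFin_eq_sum b, alternatizeUncurryFin_eq_sum b A, wedgeAlt_smul_left,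
    wedgeAlt_sum_left, pow_succ, key]
  module

theorem eq_zero_of_finrank_lt {q : ℕ} (h : Module.finrank ℝ E < q) (α : E [⋀^Fin q]→L[ℝ] ℝ) :
    α = 0 := by
  ext v
  refine α.toAlternatingMap.map_linearDependent v fun hv => ?_
  have := hv.fintype_card_le_finrank
  simp at this
  omega

end FiniteDimensional

/-! ### The contraction `Λ` dual to `L`, its naturality, its smoothness and the commutator `[L, Λ]`.
-/

section Contraction

variable {E : Type*} [NormedAddCommGroup E] [NormedSpace ℝ E]

/-- The map `v ↦ σ (v, ·)`, linear in `σ`. -/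
def flatCLM (E : Type*) [NormedAddCommGroup E] [NormedSpace ℝ E] :
    (E [⋀^Fin 2]→L[ℝ] ℝ) →L[ℝ] E →L[ℝ] E →L[ℝ] ℝ :=
  ContinuousLinearMap.compL ℝ E (E [⋀^Fin 1]→L[ℝ] ℝ) (E →L[ℝ] ℝ)
    ((ContinuousAlternatingMap.ofSubsingletonLIE (𝕜 := ℝ) (E := E) (F := ℝ) (0 : Fin 1)).symm :
      (E [⋀^Fin 1]→L[ℝ] ℝ) →L[ℝ] E →L[ℝ] ℝ) ∘L
  (ContinuousAlternatingMap.curryLeftLI (𝕜 := ℝ) (E := E) (F := ℝ) (n := 1)).toContinuousLinearMap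

theorem flatCLM_apply (σ : E [⋀^Fin 2]→L[ℝ] ℝ) (v w : E) : flatCLM E σ v w = σ ![v, w] := by
  refine congrArg σ (funext fun i => ?_)
  fin_cases i <;> rfl

theorem curryLeft_two_eq (σ : E [⋀^Fin 2]→L[ℝ] ℝ) (v : E) :
    σ.curryLeft v = oneForm (flatCLM E σ v) := by
  refine (eq_oneForm _).trans ?_
  rfl

theorem flatCLM_swap (σ : E [⋀^Fin 2]→L[ℝ] ℝ) (v w : E) :
    flatCLM E σ v w = -flatCLM E σ w v := by
  rw [flatCLM_apply, flatCLM_apply]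
  refine (congrArg σ ?_).trans (σ.toAlternatingMap.map_swap ![w, v] (zero_ne_one))
  refine (funext fun i => ?_)
  fin_cases i <;> rfl

/-- Double contraction: `(v, w) ↦ α (v, w, ·)`. -/
def curryTwo {q : ℕ} (α : E [⋀^Fin (q + 2)]→L[ℝ] ℝ) : E →ₗ[ℝ] E →ₗ[ℝ] E [⋀^Fin q]→L[ℝ] ℝ :=
  LinearMap.mk₂ ℝ (fun v w => (α.curryLeft v).curryLeft w)
    (fun v v' w => by rw [map_add]; rfl) (fun c v w => by rw [map_smul]; rfl)
    (fun v w w' => map_add _ _ _) (fun c v w => map_smul _ _ _)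

theorem curryTwo_apply {q : ℕ} (α : E [⋀^Fin (q + 2)]→L[ℝ] ℝ) (v w : E) :
    curryTwo α v w = (α.curryLeft v).curryLeft w := rfl

theorem curryTwo_add {q : ℕ} (α β : E [⋀^Fin (q + 2)]→L[ℝ] ℝ) :
    curryTwo (α + β) = curryTwo α + curryTwo β := rfl

theorem curryTwo_smul {q : ℕ} (c : ℝ) (α : E [⋀^Fin (q + 2)]→L[ℝ] ℝ) :
    curryTwo (c • α) = c • curryTwo α := rfl

theorem flatCLM_comp_apply (A : E →L[ℝ] E) (σ : E [⋀^Fin 2]→L[ℝ] ℝ) (v w : E) :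
    flatCLM E (σ.compContinuousLinearMap A) v w = flatCLM E σ (A v) (A w) := by
  rw [flatCLM_apply, flatCLM_apply]
  refine congrArg σ (funext fun i => ?_)
  fin_cases i <;> rfl

theorem curryTwo_comp (A : E →L[ℝ] E) {q : ℕ} (α : E [⋀^Fin (q + 2)]→L[ℝ] ℝ) (v w : E) :
    curryTwo (α.compContinuousLinearMap A) v w =
      (curryTwo α (A v) (A w)).compContinuousLinearMap A := by
  rw [curryTwo_apply, curryTwo_apply]
  have h1 := ContinuousAlternatingMap.curryLeft_compContinuousLinearMap α A v
  have h2 := ContinuousAlternatingMap.curryLeft_compContinuousLinearMap (α.curryLeft (A v)) A w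
  exact (congrArg (fun β => ContinuousAlternatingMap.curryLeft β w) h1).trans h2

theorem contDiff_curryLeft {q : ℕ} {r : WithTop ℕ∞} :
    ContDiff ℝ r (fun β : E [⋀^Fin (q + 1)]→L[ℝ] ℝ => β.curryLeft) := by
  have h := LinearIsometry.contDiff (𝕜 := ℝ) (n := r) (E := E [⋀^Fin (q + 1)]→L[ℝ] ℝ)
    (F := E →L[ℝ] E [⋀^Fin q]→L[ℝ] ℝ)
    (ContinuousAlternatingMap.curryLeftLI (𝕜 := ℝ) (E := E) (F := ℝ) (n := q))
  exact h

variable [FiniteDimensional ℝ E] {ι : Type*} [Fintype ι] (e : Module.Basis ι ℝ E)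

/-- The contraction of forms with the bivector inverse to the `2`-form `σ`. -/
def contract (σ : E [⋀^Fin 2]→L[ℝ] ℝ) {q : ℕ} (α : E [⋀^Fin (q + 2)]→L[ℝ] ℝ) :
    E [⋀^Fin q]→L[ℝ] ℝ :=
  (1 / 2 : ℝ) • ∑ a, curryTwo α ((flatCLM E σ).inverse (dual e a)) (e a)

theorem contract_add (σ : E [⋀^Fin 2]→L[ℝ] ℝ) {q : ℕ} (α β : E [⋀^Fin (q + 2)]→L[ℝ] ℝ) :
    contract e σ (α + β) = contract e σ α + contract e σ β := by
  simp only [contract, curryTwo_add, LinearMap.add_apply, Finset.sum_add_distrib, smul_add]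

theorem contract_smul (σ : E [⋀^Fin 2]→L[ℝ] ℝ) {q : ℕ} (c : ℝ) (α : E [⋀^Fin (q + 2)]→L[ℝ] ℝ) :
    contract e σ (c • α) = c • contract e σ α := by
  simp only [contract, curryTwo_smul, LinearMap.smul_apply, ← Finset.smul_sum, smul_comm c]

/-- The sum evaluates `φ` on the canonical element of `E* ⊗ E`, which does not depend on a basis. It
is needed because a linear change of coordinates moves the basis used in `contract`. -/
theorem sum_dual_basis_independent {κ F : Type*} [Fintype κ] [AddCommGroup F]
    [Module ℝ F] (f : Module.Basis κ ℝ E) (φ : (E →L[ℝ] ℝ) →ₗ[ℝ] E →ₗ[ℝ] F) :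
    ∑ a, φ (dual e a) (e a) = ∑ b, φ (dual f b) (f b) := by
  have h1 : ∀ a, φ (dual e a) (e a) = ∑ b, dual e a (f b) • φ (dual f b) (e a) := by
    intro a
    conv_lhs => rw [← sum_apply_smul_dual f (dual e a)]
    simp
  have h2 : ∀ b, φ (dual f b) (f b) = ∑ a, dual e a (f b) • φ (dual f b) (e a) := by
    intro b
    conv_lhs => rw [← sum_dual_smul e (f b)]
    simp
  rw [Finset.sum_congr rfl fun a _ => h1 a, Finset.sum_comm, Finset.sum_congr rfl fun b _ => h2 b]

/-- Nondegeneracy is injectivity of `v ↦ σ(v, ·)`, a map between spaces of equal dimension. -/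
theorem isInvertible_flatCLM {σ : E [⋀^Fin 2]→L[ℝ] ℝ} (h : ∀ v, (∀ w, σ ![v, w] = 0) → v = 0) :
    (flatCLM E σ).IsInvertible := by
  have hinj : Function.Injective (flatCLM E σ) := by
    rw [injective_iff_map_eq_zero]
    intro v hv
    refine h v fun w => ?_
    rw [← flatCLM_apply, hv]; rfl
  have hdim : Module.finrank ℝ E = Module.finrank ℝ (E →L[ℝ] ℝ) := by
    rw [← LinearMap.toContinuousLinearMap.finrank_eq]
    exact (Subspace.dual_finrank_eq (K := ℝ) (V := E)).symm
  let T := LinearEquiv.ofInjectiveOfFinrankEq (flatCLM E σ).toLinearMap hinj hdim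
  exact ⟨T.toContinuousLinearEquiv, by ext; rfl⟩

theorem isInvertible_flatCLM_comp (A : E ≃L[ℝ] E) {σ : E [⋀^Fin 2]→L[ℝ] ℝ}
    (h : (flatCLM E σ).IsInvertible) :
    (flatCLM E (σ.compContinuousLinearMap (A : E →L[ℝ] E))).IsInvertible := by
  refine isInvertible_flatCLM fun v hv => ?_
  have hz : flatCLM E σ (A v) = 0 := by
    ext w
    have := hv (A.symm w)
    rw [← flatCLM_apply, flatCLM_comp_apply] at this
    simpa using this
  have := h.inverse_apply_self (A v)
  rw [hz, map_zero] at this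
  exact (map_eq_zero_iff A A.injective).1 this.symm

omit [Fintype ι] in
theorem dual_map_apply (A : E ≃L[ℝ] E) (a : ι) (w : E) :
    dual (e.map A.toLinearEquiv) a (A w) = dual e a w := by
  simp [dual]

omit [Fintype ι] in
theorem apply_inverse_flatCLM_comp (A : E ≃L[ℝ] E) {σ : E [⋀^Fin 2]→L[ℝ] ℝ}
    (h : (flatCLM E σ).IsInvertible) (a : ι) :
    A ((flatCLM E (σ.compContinuousLinearMap (A : E →L[ℝ] E))).inverse (dual e a)) =
      (flatCLM E σ).inverse (dual (e.map A.toLinearEquiv) a) := by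
  have h' := isInvertible_flatCLM_comp A h
  rw [← h.inverse_apply_self
    (A ((flatCLM E (σ.compContinuousLinearMap (A : E →L[ℝ] E))).inverse (dual e a)))]
  congr 1
  ext w
  obtain ⟨w, rfl⟩ := A.surjective w
  have h1 := flatCLM_comp_apply (A : E →L[ℝ] E) σ
    ((flatCLM E (σ.compContinuousLinearMap (A : E →L[ℝ] E))).inverse (dual e a)) w
  rw [h'.self_apply_inverse] at h1
  rw [dual_map_apply]
  exact h1.symm

/-- The contraction is natural. -/
theorem contract_comp (A : E ≃L[ℝ] E) {σ : E [⋀^Fin 2]→L[ℝ] ℝ} (h : (flatCLM E σ).IsInvertible)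
    {q : ℕ} (α : E [⋀^Fin (q + 2)]→L[ℝ] ℝ) :
    contract e (σ.compContinuousLinearMap (A : E →L[ℝ] E))
      (α.compContinuousLinearMap (A : E →L[ℝ] E)) =
      (contract e σ α).compContinuousLinearMap (A : E →L[ℝ] E) := by
  have hsum : ∑ a, curryTwo α ((flatCLM E σ).inverse (dual e a)) (e a) = ∑ a, curryTwo α
      ((flatCLM E σ).inverse (dual (e.map A.toLinearEquiv) a)) (e.map A.toLinearEquiv a) :=
    sum_dual_basis_independent e (e.map A.toLinearEquiv)
      ((curryTwo α) ∘ₗ (flatCLM E σ).inverse.toLinearMap)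
  have h1 : contract e σ α = (1 / 2 : ℝ) • ∑ a, curryTwo α
      ((flatCLM E σ).inverse (dual (e.map A.toLinearEquiv) a)) (e.map A.toLinearEquiv a) :=
    by rw [contract, hsum]
  rw [h1, contract]
  ext v
  rw [ContinuousAlternatingMap.compContinuousLinearMap_apply,
    ContinuousAlternatingMap.smul_apply, ContinuousAlternatingMap.smul_apply,
    ContinuousAlternatingMap.sum_apply, ContinuousAlternatingMap.sum_apply]
  congr 1
  refine Finset.sum_congr rfl fun a _ => ?_
  rw [curryTwo_comp, ← apply_inverse_flatCLM_comp e A h a]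
  rfl

/-- Inversion of continuous linear maps is smooth at an invertible map; the rest of the contraction
is linear in each ingredient. -/
theorem contDiffAt_contract {q : ℕ} {r : WithTop ℕ∞} {s : E → E [⋀^Fin 2]→L[ℝ] ℝ}
    {a : E → E [⋀^Fin (q + 2)]→L[ℝ] ℝ} {y : E} (hs : ContDiffAt ℝ r s y) (ha : ContDiffAt ℝ r a y)
    (h : (flatCLM E (s y)).IsInvertible) : ContDiffAt ℝ r (fun z => contract e (s z) (a z)) y := by
  obtain ⟨T, hT⟩ := h
  have h1 : ContDiffAt ℝ r (fun z => (flatCLM E (s z)).inverse) y := by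
    refine ContDiffAt.comp y (g := ContinuousLinearMap.inverse) (f := fun z => flatCLM E (s z))
      ?_ ?_
    swap
    · exact (ContinuousLinearMap.contDiff (E := E [⋀^Fin 2]→L[ℝ] ℝ) (F := E →L[ℝ] E →L[ℝ] ℝ)
        (flatCLM E)).contDiffAt.comp y hs
    rw [← hT]
    exact contDiffAt_map_inverse T
  refine ContDiffAt.const_smul _ (ContDiffAt.sum fun b _ => ?_)
  have h2 : ContDiffAt ℝ r
      (fun z => (a z).curryLeft ((flatCLM E (s z)).inverse (dual e b))) y :=
    (contDiff_curryLeft.contDiffAt.comp y ha).clm_apply (h1.clm_apply contDiffAt_const)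
  exact (contDiff_curryLeft.contDiffAt.comp y h2).clm_apply contDiffAt_const

/-- The commutator of the Lefschetz operator and the contraction. -/
theorem contract_commutator {σ : E [⋀^Fin 2]→L[ℝ] ℝ} (h : (flatCLM E σ).IsInvertible)
    {q : ℕ} (α : E [⋀^Fin (q + 2)]→L[ℝ] ℝ) :
    wedgeAlt (contract e σ α) σ =
      contract e σ (wedgeAlt α σ) + ((q : ℝ) + 2 - Fintype.card ι / 2) • α := by
  set w : ι → E := fun a => (flatCLM E σ).inverse (dual e a) with hw
  have hσw : ∀ a, flatCLM E σ (w a) = dual e a := fun a => h.self_apply_inverse _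
  -- Two applications of the product rule for contractions: both vectors hit `α`, one hits each
  -- factor (in two ways), or both hit `σ`. The last case gives `σ(w a, e a) = 1`.
  have hterm : ∀ a, ((wedgeAlt α σ).curryLeft (w a)).curryLeft (e a) =
      wedgeAlt ((α.curryLeft (w a)).curryLeft (e a)) σ +
        (-1 : ℝ) ^ (q + 1) • wedgeAlt (α.curryLeft (w a)) (oneForm (flatCLM E σ (e a))) +
        (-1 : ℝ) ^ (q + 2) • wedgeAlt (α.curryLeft (e a)) (oneForm (dual e a)) + α := by
    intro a
    have h1 : (wedgeAlt α σ).curryLeft (w a) = wedgeAlt (α.curryLeft (w a)) σ +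
        (-1 : ℝ) ^ (q + 2) • wedgeAlt α (oneForm (dual e a)) := by
      refine (curryLeft_wedgeAlt_two α σ (w a)).trans ?_
      rw [curryLeft_two_eq, hσw]
    have h2 := curryLeft_wedgeAlt_two (α.curryLeft (w a)) σ (e a)
    rw [curryLeft_two_eq] at h2
    have h3 := curryLeft_wedgeAlt_oneForm α (dual e a) (e a)
    have h4 : dual e a (e a) = 1 := by simp [dual]
    rw [h4, mul_one] at h3
    have h5 : (-1 : ℝ) ^ (q + 2) * (-1 : ℝ) ^ (q + 2) = 1 := by
      rw [← pow_add, Even.neg_one_pow ⟨_, rfl⟩]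
    refine (congrArg (fun β => ContinuousAlternatingMap.curryLeft β (e a)) h1).trans ?_
    refine (congrArg₂ (fun β γ => β + (-1 : ℝ) ^ (q + 2) • γ) h2 h3).trans ?_
    rw [smul_add, smul_smul]
    refine Eq.trans ?_ (add_assoc _ _ _).symm
    congr 2
    refine (congrArg (fun c : ℝ => c • α) h5).trans (one_smul _ _)
  have hE : ∑ a, wedgeAlt (α.curryLeft (e a)) (oneForm (dual e a)) =
      ((-1 : ℝ) ^ (q + 1) * ((q + 1 : ℕ) + 1)) • α := sum_wedgeAlt_curryLeft e α
  -- The second mixed sum is minus an Euler sum: expand `σ(e a, ·)` in the dual basis and resum the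
  -- `w a`. By antisymmetry of `σ` they recombine to `-e b`.
  have hS : ∑ a, wedgeAlt (α.curryLeft (w a)) (oneForm (flatCLM E σ (e a))) =
      -∑ a, wedgeAlt (α.curryLeft (e a)) (oneForm (dual e a)) := by
    have hx : ∀ b, ∑ a, flatCLM E σ (e a) (e b) • w a = -e b := by
      intro b
      have : flatCLM E σ (∑ a, flatCLM E σ (e a) (e b) • w a) = flatCLM E σ (-e b) := by
        rw [map_sum, map_neg]
        simp only [map_smul, hσw]
        ext u
        have h6 := congrArg (fun ξ : E →L[ℝ] ℝ => ξ u) (sum_apply_smul_dual e (flatCLM E σ (e b)))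
        simp only [sum_apply, smul_apply, smul_eq_mul] at h6
        simp only [sum_apply, smul_apply, neg_apply, smul_eq_mul, ← h6, flatCLM_swap σ _ (e b),
          neg_mul, Finset.sum_neg_distrib]
      rw [← h.inverse_apply_self (∑ a, flatCLM E σ (e a) (e b) • w a), this,
        h.inverse_apply_self]
    have hy : ∀ a, wedgeAlt (α.curryLeft (w a)) (oneForm (flatCLM E σ (e a))) =
        ∑ b, flatCLM E σ (e a) (e b) • wedgeAlt (α.curryLeft (w a)) (oneForm (dual e b)) := by
      intro a
      conv_lhs => rw [← sum_apply_smul_dual e (flatCLM E σ (e a))]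
      have : oneForm (∑ b, flatCLM E σ (e a) (e b) • dual e b) =
        ∑ b, flatCLM E σ (e a) (e b) • oneForm (dual e b) := by
        ext v; simp
      rw [this, wedgeAlt_sum_right]
      exact Finset.sum_congr rfl fun b _ => wedgeAlt_smul_right _ _ _
    rw [Finset.sum_congr rfl fun a _ => hy a, Finset.sum_comm, ← Finset.sum_neg_distrib]
    refine Finset.sum_congr rfl fun b _ => ?_
    rw [← wedgeAlt_neg_left, ← map_neg, ← hx b, map_sum, wedgeAlt_sum_left]
    refine Finset.sum_congr rfl fun a _ => ?_
    rw [map_smul, wedgeAlt_smul_left]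
  have hL : wedgeAlt (contract e σ α) σ =
      (1 / 2 : ℝ) • ∑ a, wedgeAlt ((α.curryLeft (w a)).curryLeft (e a)) σ := by
    rw [contract, wedgeAlt_smul_left, wedgeAlt_sum_left]
    rfl
  have hR : contract e σ (wedgeAlt α σ) =
      (1 / 2 : ℝ) • ∑ a, ((wedgeAlt α σ).curryLeft (w a)).curryLeft (e a) := rfl
  rw [hL, hR, Finset.sum_congr rfl fun a _ => hterm a]
  simp only [Finset.sum_add_distrib, ← Finset.smul_sum]
  rw [Finset.sum_const, Finset.card_univ, ← Nat.cast_smul_eq_nsmul ℝ, hS, hE]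
  have hq : (-1 : ℝ) ^ (q + 1) * (-1 : ℝ) ^ (q + 1) = 1 := by
    rw [← pow_add, Even.neg_one_pow ⟨_, rfl⟩]
  have hq2 : (-1 : ℝ) ^ (q + 2) = -(-1 : ℝ) ^ (q + 1) := by ring
  rw [hq2]
  push_cast
  generalize (-1 : ℝ) ^ (q + 1) = s at hq
  match_scalars
  · ring
  · linear_combination ((q : ℝ) + 2) * hq
end Contraction

/-! ### The Leibniz rules, `d² = 0` and `Λ` for forms on a manifold. -/

section FormsOnManifold

variable {E : Type*} [NormedAddCommGroup E] [NormedSpace ℝ E]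
  {M : Type*} [TopologicalSpace M] [ChartedSpace E M]

theorem chartRep_wedge_form {p q : ℕ} (α : Form E M p) (β : Form E M q) (x₀ : M) (y : E) :
    chartRep (wedge α β).1 x₀ y = wedgeAlt (chartRep α.1 x₀ y) (chartRep β.1 x₀ y) :=
  wedgeAlt_comp _ _ _

theorem chartRep_wedge_eq {p q : ℕ} (α : Form E M p) (β : Form E M q) (x₀ : M) :
    chartRep (wedge α β).1 x₀ =
      fun y => wedgeCLM E p q (chartRep α.1 x₀ y) (chartRep β.1 x₀ y) :=
  funext fun y => chartRep_wedge_form α β x₀ y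

theorem compContinuousLinearMap_equiv_injective {q : ℕ} (A : E ≃L[ℝ] E)
    {a b : E [⋀^Fin q]→L[ℝ] ℝ}
    (h : a.compContinuousLinearMap (A : E →L[ℝ] E) = b.compContinuousLinearMap (A : E →L[ℝ] E)) :
    a = b := by
  ext v
  have h3 := congrArg (fun γ : E [⋀^Fin q]→L[ℝ] ℝ => γ (fun i => A.symm (v i))) h
  simpa [Function.comp_def] using h3

theorem wedge_assoc_two {p q : ℕ} (α : Form E M p) (β : Form E M q) (σ : Form E M 2) :
    wedge (wedge α β) σ = wedge α (wedge β σ) :=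
  Subtype.ext (funext fun x => wedgeAlt_wedgeAlt_two (E := E) (α.1 x) (β.1 x) (σ.1 x))

theorem form_eq_zero_of_finrank_lt [FiniteDimensional ℝ E] {q : ℕ}
    (h : Module.finrank ℝ E < q) (α : Form E M q) : α = 0 :=
  Subtype.ext (funext fun x => eq_zero_of_finrank_lt (E := E) h (α.1 x))

variable [IsManifold 𝓘(ℝ, E) ∞ M]

theorem exists_equiv_mfderiv_symm {x₀ : M} {y : E} (hy : y ∈ (extChartAt 𝓘(ℝ, E) x₀).target) :
    ∃ A : E ≃L[ℝ] E, (A : E →L[ℝ] E) =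
      (mfderiv 𝓘(ℝ, E) 𝓘(ℝ, E) (extChartAt 𝓘(ℝ, E) x₀).symm y : E →L[ℝ] E) := by
  have h := isInvertible_mfderivWithin_extChartAt_symm (I := 𝓘(ℝ, E)) hy
  rw [ModelWithCorners.range_eq_univ, mfderivWithin_univ] at h
  exact h

theorem eq_of_chartRep_eq {q : ℕ} {α β : RawForm E M q} {x₀ : M} {y : E}
    (hy : y ∈ (extChartAt 𝓘(ℝ, E) x₀).target) (h : chartRep α x₀ y = chartRep β x₀ y) :
    α ((extChartAt 𝓘(ℝ, E) x₀).symm y) = β ((extChartAt 𝓘(ℝ, E) x₀).symm y) := by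
  obtain ⟨A, hA⟩ := exists_equiv_mfderiv_symm hy
  have h' : (α ((extChartAt 𝓘(ℝ, E) x₀).symm y) : E [⋀^Fin q]→L[ℝ] ℝ).compContinuousLinearMap
      (A : E →L[ℝ] E) = (β ((extChartAt 𝓘(ℝ, E) x₀).symm y) :
        E [⋀^Fin q]→L[ℝ] ℝ).compContinuousLinearMap (A : E →L[ℝ] E) := by
    rw [hA]; exact h
  have h2 : (α ((extChartAt 𝓘(ℝ, E) x₀).symm y) : E [⋀^Fin q]→L[ℝ] ℝ) =
      (β ((extChartAt 𝓘(ℝ, E) x₀).symm y) : E [⋀^Fin q]→L[ℝ] ℝ) := by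
    exact compContinuousLinearMap_equiv_injective A h'
  exact h2

theorem Form.ext_chartRep {q : ℕ} {α β : Form E M q}
    (h : ∀ (x₀ : M) (y : E), y ∈ (extChartAt 𝓘(ℝ, E) x₀).target →
      chartRep α.1 x₀ y = chartRep β.1 x₀ y) : α = β := by
  refine Subtype.ext (funext fun x => ?_)
  have hy := mem_extChartAt_target (I := 𝓘(ℝ, E)) x
  have h1 := eq_of_chartRep_eq hy (h x _ hy)
  have h2 : ∀ z : M, z = x → α.1 z = β.1 z → α.1 x = β.1 x := by
    rintro z rfl h; exact h
  exact h2 _ (extChartAt_to_inv x) h1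

theorem chartRep_d {q : ℕ} (α : Form E M q) {x₀ : M} {y : E}
    (hy : y ∈ (extChartAt 𝓘(ℝ, E) x₀).target) :
    chartRep (d E M q α).1 x₀ y = extDeriv (chartRep α.1 x₀) y :=
  chartRep_rawExtDeriv α hy

theorem d_d {q : ℕ} (α : Form E M q) : d E M (q + 1) (d E M q α) = 0 := by
  refine Form.ext_chartRep fun x₀ y hy => ?_
  rw [chartRep_d _ hy]
  have hev : chartRep (d E M q α).1 x₀ =ᶠ[nhds y] extDeriv (chartRep α.1 x₀) := by
    filter_upwards [(isOpen_extChartAt_target x₀).mem_nhds hy] with z hz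
    exact chartRep_d α hz
  rw [hev.extDeriv_eq, extDeriv_extDeriv_apply (chartRep_contDiffAt α hy) two_le_infty]
  rfl

/-- This is the product rule for a bilinear map, then alternatized. Signs enter only afterwards,
through the pointwise Leibniz rules. -/
theorem extDeriv_wedgeCLM {p q : ℕ} {a : E → E [⋀^Fin p]→L[ℝ] ℝ} {b : E → E [⋀^Fin q]→L[ℝ] ℝ}
    {y : E} (ha : DifferentiableAt ℝ a y) (hb : DifferentiableAt ℝ b y) :
    extDeriv (fun z => wedgeCLM E p q (a z) (b z)) y =
      ContinuousAlternatingMap.alternatizeUncurryFin (wedgeCLM E p q (a y) ∘L fderiv ℝ b y) +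
      ContinuousAlternatingMap.alternatizeUncurryFin
        ((wedgeCLM E p q).flip (b y) ∘L fderiv ℝ a y) := by
  rw [extDeriv, ContinuousLinearMap.fderiv_of_bilinear _ ha hb,
    ← ContinuousAlternatingMap.alternatizeUncurryFin_add]
  rfl

variable [FiniteDimensional ℝ E]

/-- `d (α ∧ σ) = dα ∧ σ` for a closed `2`-form `σ`. -/
theorem d_wedge_two {p : ℕ} (α : Form E M p) {σ : Form E M 2} (hσ : d E M 2 σ = 0) :
    d E M (p + 2) (wedge α σ) = wedge (d E M p α) σ := by
  refine Form.ext_chartRep fun x₀ y hy => ?_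
  have ha := (chartRep_contDiffAt α hy).differentiableAt (by simp)
  have hs := (chartRep_contDiffAt σ hy).differentiableAt (by simp)
  have h0 : extDeriv (chartRep σ.1 x₀) y = 0 := by
    rw [← chartRep_d σ hy, hσ]; rfl
  have h1 := extDeriv_wedgeCLM ha hs
  rw [alternatizeUncurryFin_wedge_right, alternatizeUncurryFin_wedge_two] at h1
  refine (chartRep_d _ hy).trans ?_
  rw [chartRep_wedge_eq]
  refine Eq.trans ?_ (chartRep_wedge_form (d E M p α) σ x₀ y).symm
  rw [chartRep_d α hy]
  refine h1.trans ?_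
  change _ • wedgeAlt _ (extDeriv (chartRep σ.1 x₀) y) + _ = _
  rw [h0]
  have h2 : wedgeAlt (chartRep α.1 x₀ y) (0 : E [⋀^Fin 3]→L[ℝ] ℝ) = 0 :=
    map_zero (wedgeCLM E p 3 _)
  refine (congrArg (fun t => (-1 : ℝ) ^ p • t + _) h2).trans ?_
  rw [smul_zero, zero_add]
  rfl

/-- `d (α ∧ η) = dα ∧ η + (-1)^p α ∧ dη` for a `1`-form `η`. -/
theorem d_wedge_one {p : ℕ} (α : Form E M p) (η : Form E M 1) :
    d E M (p + 1) (wedge α η) = wedge (d E M p α) η + (-1 : ℝ) ^ p • wedge α (d E M 1 η) := by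
  refine Form.ext_chartRep fun x₀ y hy => ?_
  have ha := (chartRep_contDiffAt α hy).differentiableAt (by simp)
  have hs := (chartRep_contDiffAt η hy).differentiableAt (by simp)
  have h1 := extDeriv_wedgeCLM ha hs
  rw [alternatizeUncurryFin_wedge_right, alternatizeUncurryFin_wedge_one] at h1
  refine (chartRep_d _ hy).trans ?_
  rw [chartRep_wedge_eq]
  refine h1.trans ?_
  refine (add_comm _ _).trans ?_
  have h2 : chartRep (wedge (d E M p α) η + (-1 : ℝ) ^ p • wedge α (d E M 1 η)).1 x₀ y =
      chartRep (wedge (d E M p α) η).1 x₀ y +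
        (-1 : ℝ) ^ p • chartRep (wedge α (d E M 1 η)).1 x₀ y := rfl
  rw [h2, chartRep_wedge_form, chartRep_wedge_form, chartRep_d α hy, chartRep_d η hy]
  rfl

variable {ι : Type*} [Fintype ι] (e : Module.Basis ι ℝ E)

theorem IsSymplectic.isInvertible {σ : Form E M 2} (hσ : IsSymplectic σ) (x : M) :
    (flatCLM E (σ.1 x)).IsInvertible :=
  isInvertible_flatCLM (E := E) (hσ.2 x)

/-- Naturality of the contraction under the invertible derivative of the inverse chart. It reduces
smoothness of `Λα` to `contDiffAt_contract`. -/
theorem chartRep_contract {σ : Form E M 2} (hσ : IsSymplectic σ) {q : ℕ} (α : RawForm E M (q + 2))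
    {x₀ : M} {y : E} (hy : y ∈ (extChartAt 𝓘(ℝ, E) x₀).target) :
    chartRep (M := M) (fun x => contract e (σ.1 x) (α x)) x₀ y =
      contract e (chartRep σ.1 x₀ y) (chartRep α x₀ y) := by
  obtain ⟨A, hA⟩ := exists_equiv_mfderiv_symm hy
  have h := contract_comp e A (hσ.isInvertible ((extChartAt 𝓘(ℝ, E) x₀).symm y))
    (α ((extChartAt 𝓘(ℝ, E) x₀).symm y))
  rw [hA] at h
  exact h.symm

theorem isInvertible_chartRep {σ : Form E M 2} (hσ : IsSymplectic σ)
    {x₀ : M} {y : E} (hy : y ∈ (extChartAt 𝓘(ℝ, E) x₀).target) :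
    (flatCLM E (chartRep σ.1 x₀ y)).IsInvertible := by
  obtain ⟨A, hA⟩ := exists_equiv_mfderiv_symm hy
  have h := isInvertible_flatCLM_comp A (hσ.isInvertible ((extChartAt 𝓘(ℝ, E) x₀).symm y))
  rw [hA] at h
  exact h

/-- Contraction with the bivector inverse to a symplectic form. -/
def contractForm {σ : Form E M 2} (hσ : IsSymplectic σ) (q : ℕ) :
    Form E M (q + 2) →ₗ[ℝ] Form E M q where
  toFun α := ⟨fun x => contract e (σ.1 x) (α.1 x), fun x₀ => by
    have h : ContDiffOn ℝ ∞ (fun y => contract e (chartRep σ.1 x₀ y) (chartRep α.1 x₀ y))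
        (extChartAt 𝓘(ℝ, E) x₀).target := fun y hy =>
      (contDiffAt_contract e (chartRep_contDiffAt σ hy) (chartRep_contDiffAt α hy)
        (isInvertible_chartRep hσ hy)).contDiffWithinAt
    exact h.congr fun y hy => chartRep_contract e hσ α.1 hy⟩
  map_add' α β := Subtype.ext (funext fun x => contract_add (E := E) e (σ.1 x) (α.1 x) (β.1 x))
  map_smul' c α := Subtype.ext (funext fun x => contract_smul (E := E) e (σ.1 x) c (α.1 x))

/-- The commutator of `L` and the contraction on forms of degree `q + 2`. -/
theorem contractForm_commutator {σ : Form E M 2} (hσ : IsSymplectic σ) {q : ℕ}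
    (α : Form E M (q + 2)) :
    wedge (contractForm e hσ q α) σ =
      contractForm e hσ (q + 2) (wedge α σ) + ((q : ℝ) + 2 - Fintype.card ι / 2) • α :=
  Subtype.ext (funext fun x => contract_commutator (E := E) e (hσ.isInvertible x) (α.1 x))

end FormsOnManifold

/-! ### Surjectivity of `L^k` on forms. -/

section Lefschetz

variable {E : Type*} [NormedAddCommGroup E] [NormedSpace ℝ E]
  {M : Type*} [TopologicalSpace M] [ChartedSpace E M] [IsManifold 𝓘(ℝ, E) ∞ M]

omit [IsManifold 𝓘(ℝ, E) ∞ M] in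
theorem wedgeAlt_constOfIsEmpty_one {p : ℕ} (α : E [⋀^Fin p]→L[ℝ] ℝ) :
    wedgeAlt α (ContinuousAlternatingMap.constOfIsEmpty ℝ E (Fin 0) (1 : ℝ)) = α := by
  ext v
  rw [wedgeAlt_eq_signedSum]
  have h := signedSum_alternating α v
  have hp : (p.factorial : ℝ) ≠ 0 := by exact_mod_cast p.factorial_ne_zero
  simp only [ContinuousAlternatingMap.constOfIsEmpty_apply, mul_one, Nat.factorial_zero,
    Nat.cast_one]
  refine (congrArg (fun t => (p.factorial : ℝ)⁻¹ * t) h).trans ?_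
  rw [inv_mul_cancel_left₀ hp]

/-- The map `L_σ^k`, with the target degree as a parameter. -/
def lef (σ : Form E M 2) (k : ℕ) {q m : ℕ} (h : q + 2 * k = m) : Form E M q →ₗ[ℝ] Form E M m :=
  h ▸ lefschetz σ k q

theorem lef_zero (σ : Form E M 2) {q : ℕ} (α : Form E M q) :
    lef σ 0 (rfl : q + 2 * 0 = q) α = α :=
  Subtype.ext (funext fun x => wedgeAlt_constOfIsEmpty_one (E := E) (α.1 x))

theorem lef_succ (σ : Form E M 2) {k q m : ℕ} (h : q + 2 * k = m) (h' : q + 2 * (k + 1) = m + 2)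
    (α : Form E M q) : lef σ (k + 1) h' α = wedge (lef σ k h α) σ := by
  subst h
  exact (wedge_assoc_two α (wedgePow σ k) σ).symm

theorem lef_lef (σ : Form E M 2) {a q m : ℕ} (h₁ : q + 2 * a = m) (α : Form E M q) :
    ∀ {b c t : ℕ} (h₂ : m + 2 * b = t) (_ : a + b = c) (h₃ : q + 2 * c = t),
      lef σ b h₂ (lef σ a h₁ α) = lef σ c h₃ α
  | 0, c, t, h₂, hc, h₃ => by
    subst hc h₁ h₂
    exact lef_zero σ _
  | b + 1, c, t, h₂, hc, h₃ => by
    subst hc h₁ h₂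
    exact (lef_succ σ rfl rfl _).trans ((congrArg (fun β => wedge β σ)
      (lef_lef σ rfl α rfl rfl (by omega))).trans (lef_succ σ _ h₃ α).symm)

variable [FiniteDimensional ℝ E]

theorem d_lef {σ : Form E M 2} (hσ : d E M 2 σ = 0) {q : ℕ} (α : Form E M q) :
    ∀ {k m : ℕ} (h : q + 2 * k = m) (h' : q + 1 + 2 * k = m + 1),
      d E M m (lef σ k h α) = lef σ k h' (d E M q α)
  | 0, m, h, h' => by
    subst h
    exact (congrArg (d E M q) (lef_zero σ α)).trans (lef_zero σ _).symm
  | k + 1, m, h, h' => by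
    subst h
    refine (congrArg (d E M _) (lef_succ σ rfl rfl α)).trans ?_
    refine (d_wedge_two _ hσ).trans ?_
    refine (congrArg (fun β => wedge β σ) (d_lef hσ α rfl
      (show q + 1 + 2 * k = q + 2 * k + 1 by omega))).trans ?_
    exact (lef_succ σ (show q + 1 + 2 * k = q + 2 * k + 1 by omega) h' _).symm

omit [IsManifold 𝓘(ℝ, E) ∞ M] [FiniteDimensional ℝ E] in
theorem wedge_smul_left {p q : ℕ} (c : ℝ) (α : Form E M p) (β : Form E M q) :
    wedge (c • α) β = c • wedge α β := map_smul (wedgeRight p β) c α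

omit [IsManifold 𝓘(ℝ, E) ∞ M] [FiniteDimensional ℝ E] in
theorem wedge_sub_left {p q : ℕ} (α α' : Form E M p) (β : Form E M q) :
    wedge (α - α') β = wedge α β - wedge α' β := map_sub (wedgeRight p β) α α'

variable {ι : Type*} [Fintype ι] (e : Module.Basis ι ℝ E)

/-- An eigenform of `L Λ` with the eigenvalue of the lowest weight strings is a multiple of
`L^{i+1}`. -/
theorem exists_lef_eq_of_eigen {σ : Form E M 2} (hσ : IsSymplectic σ) {n : ℕ}
    (hn : Fintype.card ι = 2 * n) {p : ℕ} :
    ∀ (i j : ℕ) (_ : n = p + i + 1 + j) (b : Form E M (p + 2 * i + 2))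
      (_ : wedge (contractForm e hσ (p + 2 * i) b) σ = (((j : ℝ) + 1) * (i + 1)) • b),
      ∃ γ : Form E M p, lef σ (i + 1) (rfl : p + 2 * (i + 1) = p + 2 * i + 2) γ = b
  | 0, j, hj, b, hb => by
    have hc : ((j : ℝ) + 1) * ((0 : ℕ) + 1) ≠ 0 := by positivity
    refine ⟨(((j : ℝ) + 1) * ((0 : ℕ) + 1))⁻¹ • contractForm e hσ (p + 2 * 0) b, ?_⟩
    refine (lef_succ σ rfl rfl _).trans ?_
    refine (congrArg (fun β => wedge β σ) (lef_zero σ _)).trans ?_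
    rw [wedge_smul_left]
    refine (congrArg (fun β => _ • β) hb).trans ?_
    rw [smul_smul, inv_mul_cancel₀ hc, one_smul]
  | i + 1, j, hj, b, hb => by
    have hc : ((j : ℝ) + 1) * ((i + 1 : ℕ) + 1) ≠ 0 := by positivity
    set b' : Form E M (p + 2 * i + 2) := contractForm e hσ (p + 2 * (i + 1)) b with hb'
    have h1 := contractForm_commutator e hσ b'
    have h2 : contractForm e hσ (p + 2 * i + 2) (wedge b' σ) =
        (((j : ℝ) + 1) * ((i + 1 : ℕ) + 1)) • b' :=
      (congrArg (contractForm e hσ (p + 2 * i + 2)) hb).trans (map_smul _ _ _)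
    -- With `b' = Λb` and `Lb' = c b`, the commutator gives `LΛb' = (c + deg b' - n) b'`. Here `c =
    -- (j+1)(i+2)` and `deg b' - n = i - j`, so the new eigenvalue is `(j+2)(i+1)`: one step down
    -- the string.
    have h3 : wedge (contractForm e hσ (p + 2 * i) b') σ =
        ((((j + 1 : ℕ) : ℝ) + 1) * ((i : ℝ) + 1)) • b' := by
      rw [h1, h2, ← add_smul, hn]
      congr 1
      subst hj
      push_cast
      ring
    obtain ⟨γ, hγ⟩ := exists_lef_eq_of_eigen hσ hn i (j + 1) (by omega) b' h3
    refine ⟨(((j : ℝ) + 1) * ((i + 1 : ℕ) + 1))⁻¹ • γ, ?_⟩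
    refine (lef_succ σ rfl rfl _).trans ?_
    refine (congrArg (fun β => wedge β σ)
      ((map_smul (lef σ (i + 1) rfl) _ γ).trans (congrArg _ hγ))).trans ?_
    rw [wedge_smul_left]
    refine (congrArg (fun β => _ • β) hb).trans ?_
    rw [smul_smul, inv_mul_cancel₀ hc, one_smul]

/-- If `Lb = 0`, the commutator reduces to `LΛb = (deg b - n) b = (i+1) b`, the case `j = 0` of the
eigenform lemma. -/
theorem exists_lef_eq_of_wedge_eq_zero (e : Module.Basis ι ℝ E) {σ : Form E M 2} (hσ : IsSymplectic σ) {n : ℕ}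
    (hn : Fintype.card ι = 2 * n) {p i : ℕ} (hpi : n = p + i + 1) (b : Form E M (p + 2 * i + 2))
    (hb : wedge b σ = 0) :
    ∃ γ : Form E M p, lef σ (i + 1) (rfl : p + 2 * (i + 1) = p + 2 * i + 2) γ = b := by
  refine exists_lef_eq_of_eigen e hσ hn i 0 (by omega) b ?_
  rw [contractForm_commutator, hb, map_zero, zero_add, hn]
  congr 1
  subst hpi
  push_cast
  ring

/-- `L^m : Ω^{n-m} → Ω^{n+m}` is surjective. -/
theorem lef_surjective_of_add_eq {σ : Form E M 2} (hσ : IsSymplectic σ) {n : ℕ}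
    (hn : Module.finrank ℝ E = 2 * n) (p : ℕ) :
    ∀ (m t : ℕ) (h : p + 2 * m = t) (_ : p + m = n), Function.Surjective
      (lef σ m h : Form E M p →ₗ[ℝ] Form E M t) := by
  induction p using Nat.strong_induction_on with
  | _ p ih =>
    intro m t h hm β
    subst h
    rcases m with _ | i
    · exact ⟨β, lef_zero σ β⟩
    have hcard : Fintype.card (Fin (Module.finrank ℝ E)) = 2 * n := by simpa using hn
    have key := fun b hb => exists_lef_eq_of_wedge_eq_zero (Module.finBasis ℝ E) hσ hcard
      (p := p) (i := i) (by omega) b hb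
    -- For `p < 2` the degree `p + 2(i+1) + 2` of `β ∧ σ` exceeds `2n = 2p + 2(i+1)`, so `β` itself
    -- is killed by `L`.
    by_cases hp : p < 2
    · exact key β (form_eq_zero_of_finrank_lt (by omega) _)
    obtain ⟨p', rfl⟩ : ∃ p', p = p' + 2 := ⟨p - 2, by omega⟩
    -- Lowering the source degree by `2` raises the exponent from `i + 1` to `i + 3`, so the
    -- induction hypothesis gives `Lβ = L^{i+3} γ'`. Then `β - L^{i+1}(Lγ')` is killed by `L`.
    obtain ⟨γ', hγ'⟩ := ih p' (by omega) (i + 3) (p' + 2 + 2 * (i + 1) + 2) (by omega) (by omega)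
      (wedge β σ)
    set γ₁ : Form E M (p' + 2) := lef σ 1 (rfl : p' + 2 * 1 = p' + 2) γ'
    have h1 : wedge (lef σ (i + 1) (rfl : p' + 2 + 2 * (i + 1) = _) γ₁) σ = wedge β σ := by
      rw [← hγ', ← lef_succ σ rfl rfl]
      exact lef_lef σ rfl γ' rfl (by omega) (by omega)
    obtain ⟨γ₂, hγ₂⟩ := key (β - lef σ (i + 1) rfl γ₁) (by
      refine (wedge_sub_left _ _ _).trans ?_
      exact sub_eq_zero.2 h1.symm)
    refine ⟨γ₁ + γ₂, ?_⟩
    rw [map_add]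
    exact (congrArg _ hγ₂).trans (add_sub_cancel _ _)

/-- `L^k : Ω^p → Ω^{p+2k}` is surjective for `p ≥ n - k`. -/
theorem lef_surjective {σ : Form E M 2} (hσ : IsSymplectic σ) {n : ℕ}
    (hn : Module.finrank ℝ E = 2 * n) {p k t : ℕ} (h : p + 2 * k = t) (hk : n ≤ p + k) :
    Function.Surjective (lef σ k h : Form E M p →ₗ[ℝ] Form E M t) := by
  intro β
  by_cases ht : 2 * n < t
  · exact ⟨0, by rw [map_zero, form_eq_zero_of_finrank_lt (hn ▸ ht) β]⟩
  -- The surjection `L^{t-n} : Ω^{2n-t} → Ω^t` factors through `Ω^p` as `L^k` after `L^{p+k-n}`.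
  obtain ⟨γ, hγ⟩ := lef_surjective_of_add_eq hσ hn (2 * n - t) (t - n) t (by omega) (by omega) β
  refine ⟨lef σ (p + k - n) (by omega) γ, ?_⟩
  rw [← hγ]
  exact lef_lef σ _ γ h (by omega) (by omega)

end Lefschetz

/-! ### The long exact sequence: kernel and range of `H^q_{(k)} → H^q`. -/

section CohomologyMaps

variable {E : Type*} [NormedAddCommGroup E] [NormedSpace ℝ E]
  {M : Type*} [TopologicalSpace M] [ChartedSpace E M] [IsManifold 𝓘(ℝ, E) ∞ M]

theorem mem_cocycles_allForms {q : ℕ} {α : Form E M q} :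
    α ∈ cocycles (allForms E M) q ↔ d E M q α = 0 := by
  simp [cocycles, allForms]

theorem mem_coboundaries_allForms_succ {q : ℕ} {α : Form E M (q + 1)} :
    α ∈ coboundaries (allForms E M) (q + 1) ↔ ∃ β, d E M q β = α := by
  simp [coboundaries, allForms]

theorem mem_cocycles_coeffective {σ : Form E M 2} {k q : ℕ} {α : Form E M q} :
    α ∈ cocycles (coeffective σ k) q ↔ lefschetz σ k q α = 0 ∧ d E M q α = 0 := by
  simp [cocycles, coeffective]

theorem mem_coboundaries_coeffective_succ {σ : Form E M 2} {k q : ℕ} {α : Form E M (q + 1)} :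
    α ∈ coboundaries (coeffective σ k) (q + 1) ↔
      ∃ β, lefschetz σ k q β = 0 ∧ d E M q β = α := by
  simp [coboundaries, coeffective]

theorem mem_connectingForms_succ {σ : Form E M 2} {k q : ℕ} {α : Form E M (q + 1)} :
    α ∈ connectingForms σ k (q + 1) ↔
      ∃ β, d E M (q + 2 * k) (lefschetz σ k q β) = 0 ∧ d E M q β = α := by
  simp [connectingForms]

theorem lefschetz_eq_zero_iff {σ : Form E M 2} {k q m : ℕ} (h : q + 2 * k = m)
    {α : Form E M q} : lefschetz σ k q α = 0 ↔ lef σ k h α = 0 := by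
  subst h; rfl

theorem d_lefschetz_eq_zero_iff {σ : Form E M 2} {k q m : ℕ} (h : q + 2 * k = m)
    {α : Form E M q} : d E M _ (lefschetz σ k q α) = 0 ↔ d E M m (lef σ k h α) = 0 := by
  subst h; rfl

/-- The map `H^q_{(k)}(M) → H^q(M)` induced by the inclusion. -/
def coeffToDeRham (σ : Form E M 2) (k q : ℕ) : CoeffCohomology σ k q →ₗ[ℝ] DeRham E M q :=
  Submodule.mapQ _ _ (Submodule.inclusion (inf_le_inf_right _ le_top :
    cocycles (coeffective σ k) q ≤ cocycles (allForms E M) q)) (by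
      rintro ⟨α, hα⟩ h
      cases q with
      | zero => exact h
      | succ q =>
        exact Submodule.map_mono le_top h)

variable [FiniteDimensional ℝ E]

theorem lef_mem_cocycles {σ : Form E M 2} (hσ : d E M 2 σ = 0) {k q m : ℕ} (h : q + 2 * k = m)
    {α : Form E M q} (hα : α ∈ cocycles (allForms E M) q) :
    lef σ k h α ∈ cocycles (allForms E M) m := by
  rw [mem_cocycles_allForms] at *
  rw [d_lef hσ α h (by omega), hα, map_zero]

theorem lef_mem_coboundaries {σ : Form E M 2} (hσ : d E M 2 σ = 0) {k q m : ℕ}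
    (h : q + 2 * k = m) {α : Form E M q} (hα : α ∈ coboundaries (allForms E M) q) :
    lef σ k h α ∈ coboundaries (allForms E M) m := by
  cases q with
  | zero =>
    have : α = 0 := hα
    rw [this, map_zero]
    exact zero_mem _
  | succ q =>
    obtain ⟨β, rfl⟩ := mem_coboundaries_allForms_succ.1 hα
    obtain ⟨m', rfl⟩ : ∃ m', m = m' + 1 := ⟨q + 2 * k, by omega⟩
    exact mem_coboundaries_allForms_succ.2 ⟨lef σ k (by omega) β, d_lef hσ β _ h⟩

/-- The map induced by `L_σ^k` on the de Rham cohomology. -/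
def lefCohom {σ : Form E M 2} (hσ : d E M 2 σ = 0) (k : ℕ) {q m : ℕ} (h : q + 2 * k = m) :
    DeRham E M q →ₗ[ℝ] DeRham E M m :=
  Submodule.mapQ _ _ ((lef σ k h).restrict fun _ hα => lef_mem_cocycles hσ h hα)
    fun _ hα => lef_mem_coboundaries hσ h hα

variable {σ : Form E M 2} (hσ : d E M 2 σ = 0)

theorem lefCohom_mk {k q m : ℕ} (h : q + 2 * k = m) {α : Form E M q}
    (hα : α ∈ cocycles (allForms E M) q) :
    lefCohom hσ k h (Submodule.Quotient.mk ⟨α, hα⟩) =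
      Submodule.Quotient.mk ⟨lef σ k h α, lef_mem_cocycles hσ h hα⟩ := rfl

omit [FiniteDimensional ℝ E] in
theorem mk_eq_mk_iff {S : ∀ q, Submodule ℝ (Form E M q)} {q : ℕ} {α β : Form E M q}
    (hα : α ∈ cocycles S q) (hβ : β ∈ cocycles S q) :
    (Submodule.Quotient.mk ⟨α, hα⟩ : Cohomology S q) = Submodule.Quotient.mk ⟨β, hβ⟩ ↔
      α - β ∈ coboundaries S q :=
  Submodule.Quotient.eq _

omit [FiniteDimensional ℝ E] in
theorem mk_eq_zero_iff {S : ∀ q, Submodule ℝ (Form E M q)} {q : ℕ} {α : Form E M q}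
    (hα : α ∈ cocycles S q) :
    (Submodule.Quotient.mk ⟨α, hα⟩ : Cohomology S q) = 0 ↔ α ∈ coboundaries S q :=
  Submodule.Quotient.mk_eq_zero _

/-- The image of `H^q_{(k)}(M) → H^q(M)` is the kernel of `L_σ^k`. -/
theorem range_coeffToDeRham {k r m : ℕ} (h₀ : r + 2 * k = m) (h₁ : r + 1 + 2 * k = m + 1)
    (hsurj : Function.Surjective (lef σ k h₀)) :
    LinearMap.range (coeffToDeRham σ k (r + 1)) = LinearMap.ker (lefCohom hσ k h₁) := by
  ext c
  obtain ⟨⟨α, hα⟩, rfl⟩ := Submodule.Quotient.mk_surjective _ c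
  rw [LinearMap.mem_ker, lefCohom_mk, mk_eq_zero_iff, mem_coboundaries_allForms_succ]
  constructor
  · rintro ⟨c', hc'⟩
    obtain ⟨⟨α', hα'⟩, rfl⟩ := Submodule.Quotient.mk_surjective _ c'
    have h2 : α' - α ∈ coboundaries (allForms E M) (r + 1) := (mk_eq_mk_iff _ hα).1 hc'
    obtain ⟨γ, hγ⟩ := mem_coboundaries_allForms_succ.1 h2
    have h3 : lef σ k h₁ α' = 0 :=
      (lefschetz_eq_zero_iff h₁).1 (mem_cocycles_coeffective.1 hα').1
    refine ⟨-lef σ k h₀ γ, ?_⟩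
    rw [map_neg, d_lef hσ γ h₀ h₁, hγ, map_sub, h3, zero_sub, neg_neg]
  · rintro ⟨β, hβ⟩
    -- If `L^k α = dβ`, lifting `β = L^k γ` gives `L^k(α - dγ) = 0`, so `α - dγ` is a coeffective
    -- representative of the class of `α`.
    obtain ⟨γ, rfl⟩ := hsurj β
    rw [d_lef hσ γ h₀ h₁] at hβ
    have hα' : α - d E M r γ ∈ cocycles (coeffective σ k) (r + 1) := by
      refine mem_cocycles_coeffective.2 ⟨(lefschetz_eq_zero_iff h₁).2 ?_, ?_⟩
      · rw [map_sub, hβ, sub_self]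
      · rw [map_sub, d_d, mem_cocycles_allForms.1 hα, sub_zero]
    refine ⟨Submodule.Quotient.mk ⟨_, hα'⟩, (mk_eq_mk_iff _ hα).2 ?_⟩
    exact mem_coboundaries_allForms_succ.2 ⟨-γ, by
      rw [map_neg]
      change -d E M r γ = α - d E M r γ - α
      abel⟩

include hσ in
theorem d_lefschetz_eq_zero_of_d {k r : ℕ} {γ : Form E M r}
    (h : lefschetz σ k (r + 1) (d E M r γ) = 0) :
    d E M (r + 2 * k) (lefschetz σ k r γ) = 0 := by
  have h1 : r + 1 + 2 * k = r + 2 * k + 1 := by omega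
  rw [lefschetz_eq_zero_iff h1] at h
  exact (d_lef hσ γ rfl h1).trans h

include hσ in
theorem lefschetz_d_eq_zero {k r : ℕ} {γ : Form E M r}
    (h : d E M (r + 2 * k) (lefschetz σ k r γ) = 0) :
    lefschetz σ k (r + 1) (d E M r γ) = 0 := by
  have h1 : r + 1 + 2 * k = r + 2 * k + 1 := by omega
  rw [lefschetz_eq_zero_iff h1]
  exact (d_lef hσ γ rfl h1).symm.trans h

omit [FiniteDimensional ℝ E] in
theorem mem_connectingRange_iff {k q : ℕ} {α : Form E M q}
    (hα : α ∈ cocycles (coeffective σ k) q) :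
    (Submodule.Quotient.mk ⟨α, hα⟩ : CoeffCohomology σ k q) ∈ connectingRange σ k q ↔
      ∃ β ∈ connectingForms σ k q, α - β ∈ coboundaries (coeffective σ k) q := by
  constructor
  · rintro ⟨⟨β, hβ⟩, hβ', hc⟩
    exact ⟨β, hβ', (mk_eq_mk_iff hα hβ).1 hc.symm⟩
  · rintro ⟨β, hβ, hαβ⟩
    -- Since coeffective coboundaries are themselves connecting forms, `α` is one too and can serve
    -- as its own representative.
    have hcb : coboundaries (coeffective σ k) q ≤ connectingForms σ k q := by
      cases q with
      | zero => exact le_rfl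
      | succ q =>
        intro γ hγ
        obtain ⟨δ, hδ, rfl⟩ := mem_coboundaries_coeffective_succ.1 hγ
        exact mem_connectingForms_succ.2 ⟨δ, by rw [hδ, map_zero], rfl⟩
    refine ⟨⟨α, hα⟩, ?_, rfl⟩
    have h := add_mem (hcb hαβ) hβ
    rwa [sub_add_cancel] at h

include hσ in
/-- The kernel of `H^q_{(k)}(M) → H^q(M)` is the image of the connecting homomorphism. -/
theorem ker_coeffToDeRham (k r : ℕ) :
    LinearMap.ker (coeffToDeRham σ k (r + 1)) = connectingRange σ k (r + 1) := by
  ext c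
  obtain ⟨⟨α, hα⟩, rfl⟩ := Submodule.Quotient.mk_surjective _ c
  rw [LinearMap.mem_ker]
  have hα' : α ∈ cocycles (allForms E M) (r + 1) :=
    mem_cocycles_allForms.2 (mem_cocycles_coeffective.1 hα).2
  have h1 : coeffToDeRham σ k (r + 1) (Submodule.Quotient.mk ⟨α, hα⟩) =
      Submodule.Quotient.mk ⟨α, hα'⟩ := rfl
  rw [h1, mk_eq_zero_iff, mem_coboundaries_allForms_succ, mem_connectingRange_iff]
  constructor
  · rintro ⟨γ, rfl⟩
    refine ⟨_, mem_connectingForms_succ.2 ⟨γ, ?_, rfl⟩, by rw [sub_self]; exact zero_mem _⟩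
    exact d_lefschetz_eq_zero_of_d hσ (mem_cocycles_coeffective.1 hα).1
  · rintro ⟨β, hβ, hαβ⟩
    obtain ⟨γ, -, rfl⟩ := mem_connectingForms_succ.1 hβ
    obtain ⟨δ, -, hδ⟩ := mem_coboundaries_coeffective_succ.1 hαβ
    exact ⟨δ + γ, by rw [map_add, hδ, sub_add_cancel]⟩

/-- `Ĥ^q(M)` is isomorphic to the kernel of `L_σ^k : H^q(M) → H^{q+2k}(M)`. -/
def hatEquiv {k r m : ℕ} (h₀ : r + 2 * k = m) (h₁ : r + 1 + 2 * k = m + 1)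
    (hsurj : Function.Surjective (lef σ k h₀)) :
    HatCohomology σ k (r + 1) ≃ₗ[ℝ] LinearMap.ker (lefCohom hσ k h₁) :=
  (Submodule.quotEquivOfEq _ _ (ker_coeffToDeRham hσ k r).symm).trans
    ((coeffToDeRham σ k (r + 1)).quotKerEquivRange.trans
      (LinearEquiv.ofEq _ _ (range_coeffToDeRham hσ h₀ h₁ hsurj)))

/-- The forms `γ` with `L_σ^k γ` closed. -/
def liftedCocycles (σ : Form E M 2) (k r : ℕ) : Submodule ℝ (Form E M r) :=
  LinearMap.ker (d E M (r + 2 * k) ∘ₗ lefschetz σ k r)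

omit [FiniteDimensional ℝ E] in
theorem mem_liftedCocycles {k r m : ℕ} (h : r + 2 * k = m) {γ : Form E M r} :
    γ ∈ liftedCocycles σ k r ↔ d E M m (lef σ k h γ) = 0 :=
  d_lefschetz_eq_zero_iff h

/-- The map `γ ↦ [dγ]` into the coeffective cohomology. -/
def liftedToCoeff (k r : ℕ) : liftedCocycles σ k r →ₗ[ℝ] CoeffCohomology σ k (r + 1) :=
  Submodule.mkQ _ ∘ₗ (d E M r).restrict (p := liftedCocycles σ k r)
    (q := cocycles (coeffective σ k) (r + 1)) fun γ hγ =>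
      mem_cocycles_coeffective.2 ⟨lefschetz_d_eq_zero hσ hγ, d_d γ⟩

/-- The map `γ ↦ [L_σ^k γ]` into the de Rham cohomology modulo the image of `L_σ^k`. -/
def liftedToCoker {k r m : ℕ} (h : r + 2 * k = m) :
    liftedCocycles σ k r →ₗ[ℝ] DeRham E M m ⧸ LinearMap.range (lefCohom hσ k h) :=
  Submodule.mkQ _ ∘ₗ Submodule.mkQ _ ∘ₗ (lef σ k h).restrict (p := liftedCocycles σ k r)
    (q := cocycles (allForms E M) m) fun _ hγ =>
      mem_cocycles_allForms.2 ((mem_liftedCocycles h).1 hγ)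

theorem range_liftedToCoeff (k r : ℕ) :
    LinearMap.range (liftedToCoeff hσ k r) = connectingRange σ k (r + 1) := by
  ext c
  constructor
  · rintro ⟨⟨γ, hγ⟩, rfl⟩
    refine (mem_connectingRange_iff _).2 ⟨d E M r γ, mem_connectingForms_succ.2 ⟨γ, hγ, rfl⟩, ?_⟩
    have h0 : d E M r γ - d E M r γ ∈ coboundaries (coeffective σ k) (r + 1) := by
      rw [sub_self]; exact zero_mem _
    exact h0
  · obtain ⟨⟨α, hα⟩, rfl⟩ := Submodule.Quotient.mk_surjective _ c
    intro h
    obtain ⟨β, hβ, hαβ⟩ := (mem_connectingRange_iff _).1 h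
    obtain ⟨γ, hγ, rfl⟩ := mem_connectingForms_succ.1 hβ
    refine ⟨⟨γ, hγ⟩, ?_⟩
    refine (mk_eq_mk_iff _ hα).2 ?_
    rw [← neg_sub]
    exact neg_mem hαβ

theorem range_liftedToCoker {k r m : ℕ} (h : r + 2 * k = m)
    (hsurj : Function.Surjective (lef σ k h)) :
    LinearMap.range (liftedToCoker hσ h) = ⊤ := by
  rw [eq_top_iff]
  rintro c -
  obtain ⟨c, rfl⟩ := Submodule.Quotient.mk_surjective _ c
  obtain ⟨⟨α, hα⟩, rfl⟩ := Submodule.Quotient.mk_surjective _ c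
  obtain ⟨γ, rfl⟩ := hsurj α
  exact ⟨⟨γ, (mem_liftedCocycles h).2 (mem_cocycles_allForms.1 hα)⟩, rfl⟩

/-- If `dγ = dγ₀` with `γ₀` coeffective, then `γ - γ₀` is closed and has the same image under `L^k`
as `γ`. Conversely, if `L^k α - L^k γ = dβ` with `α` closed, lift `β = L^k δ`; then `γ - α + dδ` is
coeffective with derivative `dγ`. This lift, one degree below `γ`, is what requires `q ≥ n-k+2`
rather than `n-k+1`. -/
theorem ker_liftedToCoeff_eq {k s m : ℕ} (h₀ : s + 2 * k = m) (h₁ : s + 1 + 2 * k = m + 1)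
    (hsurj : Function.Surjective (lef σ k h₀)) :
    LinearMap.ker (liftedToCoeff hσ k (s + 1)) = LinearMap.ker (liftedToCoker hσ h₁) := by
  ext ⟨γ, hγ⟩
  have hγ' := (mem_liftedCocycles h₁).1 hγ
  have hA : liftedToCoeff hσ k (s + 1) ⟨γ, hγ⟩ = 0 ↔
      d E M (s + 1) γ ∈ coboundaries (coeffective σ k) (s + 1 + 1) := mk_eq_zero_iff _
  have hB : liftedToCoker hσ h₁ ⟨γ, hγ⟩ = 0 ↔
      (Submodule.Quotient.mk ⟨lef σ k h₁ γ, mem_cocycles_allForms.2 hγ'⟩ : DeRham E M (m + 1)) ∈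
        LinearMap.range (lefCohom hσ k h₁) := Submodule.Quotient.mk_eq_zero _
  rw [LinearMap.mem_ker, LinearMap.mem_ker, hA, hB, mem_coboundaries_coeffective_succ]
  constructor
  · rintro ⟨γ₀, hγ₀, hd⟩
    have hc : γ - γ₀ ∈ cocycles (allForms E M) (s + 1) :=
      mem_cocycles_allForms.2 (by rw [map_sub, hd, sub_self])
    refine ⟨Submodule.Quotient.mk ⟨_, hc⟩, ?_⟩
    rw [lefCohom_mk, mk_eq_mk_iff, map_sub, (lefschetz_eq_zero_iff h₁).1 hγ₀, sub_zero, sub_self]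
    exact zero_mem _
  · rintro ⟨c, hc⟩
    obtain ⟨⟨α, hα⟩, rfl⟩ := Submodule.Quotient.mk_surjective _ c
    rw [lefCohom_mk, mk_eq_mk_iff, mem_coboundaries_allForms_succ] at hc
    obtain ⟨β, hβ⟩ := hc
    obtain ⟨δ, rfl⟩ := hsurj β
    rw [d_lef hσ δ h₀ h₁] at hβ
    refine ⟨γ - α + d E M s δ, (lefschetz_eq_zero_iff h₁).2 ?_, ?_⟩
    · rw [map_add, map_sub, hβ]; abel
    · rw [map_add, map_sub, d_d, mem_cocycles_allForms.1 hα, sub_zero, add_zero]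

/-- The image of the connecting homomorphism is isomorphic to the cokernel of `L_σ^k` on
cohomology. -/
def connectingRangeEquiv {k s m : ℕ} (h₀ : s + 2 * k = m) (h₁ : s + 1 + 2 * k = m + 1)
    (hsurj₀ : Function.Surjective (lef σ k h₀)) (hsurj₁ : Function.Surjective (lef σ k h₁)) :
    connectingRange σ k (s + 1 + 1) ≃ₗ[ℝ] DeRham E M (m + 1) ⧸ LinearMap.range (lefCohom hσ k h₁) :=
  (LinearEquiv.ofEq _ _ (range_liftedToCoeff hσ k (s + 1)).symm).trans
    ((liftedToCoeff hσ k (s + 1)).quotKerEquivRange.symm.trans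
      ((Submodule.quotEquivOfEq _ _ (ker_liftedToCoeff_eq hσ h₀ h₁ hsurj₀)).trans
        ((liftedToCoker hσ h₁).quotKerEquivRange.trans
          (LinearEquiv.ofTop _ (range_liftedToCoker hσ h₁ hsurj₁)))))

end CohomologyMaps

/-! ### Dimension counts, the Hard Lefschetz Condition and exact symplectic forms. -/

section Numbers

variable {E : Type*} [NormedAddCommGroup E] [NormedSpace ℝ E] [FiniteDimensional ℝ E]
  {M : Type*} [TopologicalSpace M] [ChartedSpace E M] [IsManifold 𝓘(ℝ, E) ∞ M]
  {σ : Form E M 2}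

theorem lefCohom_lefCohom (hσ : d E M 2 σ = 0) {a b c q m t : ℕ} (h₁ : q + 2 * a = m)
    (h₂ : m + 2 * b = t) (hc : a + b = c) (h₃ : q + 2 * c = t) (x : DeRham E M q) :
    lefCohom hσ b h₂ (lefCohom hσ a h₁ x) = lefCohom hσ c h₃ x := by
  obtain ⟨⟨α, hα⟩, rfl⟩ := Submodule.Quotient.mk_surjective _ x
  rw [lefCohom_mk, lefCohom_mk, lefCohom_mk, mk_eq_mk_iff, lef_lef σ h₁ α h₂ hc h₃, sub_self]
  exact zero_mem _

theorem HardLefschetz.lefCohom_surjective_of_add_eq {n : ℕ} (H : HardLefschetz n σ)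
    (hσ : d E M 2 σ = 0) {p j t : ℕ} (h : p + 2 * j = t) (hj : 1 ≤ j) (hpj : p + j = n) :
    Function.Surjective (lefCohom hσ j h) := by
  subst h
  intro c
  obtain ⟨α, hα, h, rfl⟩ := H p j hj hpj c
  exact ⟨Submodule.Quotient.mk ⟨α, hα⟩, rfl⟩

/-- As on forms: in degrees up to `2n` the surjection `L^{t-n} : H^{2n-t} → H^t` factors through
`H^p`, and beyond `2n` the target is zero. The HLC applies with exponent `t - n ≥ k ≥ 1`. -/
theorem HardLefschetz.lefCohom_surjective {n : ℕ} (H : HardLefschetz n σ)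
    (hσ : d E M 2 σ = 0) (hn : Module.finrank ℝ E = 2 * n) {p k t : ℕ} (hk : 1 ≤ k)
    (h : p + 2 * k = t) (hpk : n ≤ p + k) : Function.Surjective (lefCohom hσ k h) := by
  intro c
  by_cases ht : 2 * n < t
  · refine ⟨0, ?_⟩
    obtain ⟨⟨α, hα⟩, rfl⟩ := Submodule.Quotient.mk_surjective _ c
    rw [map_zero, eq_comm, mk_eq_zero_iff, form_eq_zero_of_finrank_lt (hn ▸ ht) α]
    exact zero_mem _
  obtain ⟨x, hx⟩ := H.lefCohom_surjective_of_add_eq hσ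
    (show 2 * n - t + 2 * (t - n) = t by omega) (by omega) (by omega) c
  refine ⟨lefCohom hσ (p + k - n) (show 2 * n - t + 2 * (p + k - n) = p by omega) x, ?_⟩
  rw [← hx]
  exact lefCohom_lefCohom hσ _ h (by omega) _ x

/-- One factor `σ = dη` is peeled off: for closed `α` the form `α ∧ σ^{k-1}` is closed, so its
product with `σ` is, up to sign, the derivative of its product with `η`. -/
theorem IsExact.lefCohom_eq_zero (H : IsExact σ) (hσ : d E M 2 σ = 0) {p k t : ℕ} (hk : 1 ≤ k)
    (h : p + 2 * k = t) : lefCohom hσ k h = 0 := by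
  obtain ⟨η, hη⟩ := H
  obtain ⟨k, rfl⟩ : ∃ k', k = k' + 1 := ⟨k - 1, by omega⟩
  subst h
  refine LinearMap.ext fun c => ?_
  obtain ⟨⟨α, hα⟩, rfl⟩ := Submodule.Quotient.mk_surjective _ c
  rw [lefCohom_mk, LinearMap.zero_apply, mk_eq_zero_iff]
  refine mem_coboundaries_allForms_succ.2
    ⟨(-1 : ℝ) ^ (p + 2 * k) • wedge (lef σ k rfl α) η, ?_⟩
  have h1 : d E M (p + 2 * k) (lef σ k rfl α) = 0 :=
    mem_cocycles_allForms.1 (lef_mem_cocycles hσ rfl hα)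
  refine (map_smul _ _ _).trans ?_
  refine (congrArg _ (d_wedge_one (lef σ k rfl α) η)).trans ?_
  rw [h1, hη]
  have h2 : wedge (0 : Form E M (p + 2 * k + 1)) η = 0 := map_zero (wedgeRight _ η)
  refine Eq.trans ?_ (lef_succ σ rfl rfl α).symm
  refine (congrArg (fun x => (-1 : ℝ) ^ (p + 2 * k) • (x +
    (-1 : ℝ) ^ (p + 2 * k) • wedge (lef σ k rfl α) σ)) h2).trans ?_
  rw [zero_add, smul_smul, ← pow_add, Even.neg_one_pow ⟨_, rfl⟩, one_smul]

/-- The dimension of `Ĥ^{r+1}(M)` is that of the kernel of `L_σ^k` on `H^{r+1}(M)`. -/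
theorem finite_hat (hσ : d E M 2 σ = 0) {k r m : ℕ} (h₀ : r + 2 * k = m)
    (h₁ : r + 1 + 2 * k = m + 1) (hsurj : Function.Surjective (lef σ k h₀))
    [FiniteDimensional ℝ (DeRham E M (r + 1))] :
    FiniteDimensional ℝ (HatCohomology σ k (r + 1)) :=
  (hatEquiv hσ h₀ h₁ hsurj).symm.finiteDimensional

/-- Rank-nullity for `L^k` on cohomology, in additive form to avoid truncated subtraction. -/
theorem hatNumber_add_finrank_range (hσ : d E M 2 σ = 0) {k r m : ℕ} (h₀ : r + 2 * k = m)
    (h₁ : r + 1 + 2 * k = m + 1) (hsurj : Function.Surjective (lef σ k h₀))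
    [FiniteDimensional ℝ (DeRham E M (r + 1))] :
    hatNumber σ k (r + 1) + Module.finrank ℝ (LinearMap.range (lefCohom hσ k h₁)) =
      betti E M (r + 1) := by
  rw [hatNumber, (hatEquiv hσ h₀ h₁ hsurj).finrank_eq, add_comm]
  exact LinearMap.finrank_range_add_finrank_ker _

theorem finite_coeff (hσ : d E M 2 σ = 0) {k s m : ℕ} (h₀ : s + 2 * k = m)
    (h₁ : s + 1 + 2 * k = m + 1) (hsurj₀ : Function.Surjective (lef σ k h₀))
    (hsurj₁ : Function.Surjective (lef σ k h₁))
    [FiniteDimensional ℝ (DeRham E M (s + 2))] [FiniteDimensional ℝ (DeRham E M (m + 1))] :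
    FiniteDimensional ℝ (CoeffCohomology σ k (s + 2)) := by
  have h1 : FiniteDimensional ℝ (CoeffCohomology σ k (s + 2) ⧸ connectingRange σ k (s + 2)) :=
    finite_hat hσ h₁ (by omega) hsurj₁
  have h2 : FiniteDimensional ℝ (connectingRange σ k (s + 2)) :=
    (connectingRangeEquiv hσ h₀ h₁ hsurj₀ hsurj₁).symm.finiteDimensional
  exact Module.Finite.of_submodule_quotient (connectingRange σ k (s + 2))

/-- This encodes `c_q = ĉ_q + dim coker L^k`, the cokernel being the range of the connecting
homomorphism. -/
theorem coeffNumber_add_finrank_range (hσ : d E M 2 σ = 0) {k s m : ℕ} (h₀ : s + 2 * k = m)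
    (h₁ : s + 1 + 2 * k = m + 1) (hsurj₀ : Function.Surjective (lef σ k h₀))
    (hsurj₁ : Function.Surjective (lef σ k h₁))
    [FiniteDimensional ℝ (DeRham E M (s + 2))] [FiniteDimensional ℝ (DeRham E M (m + 1))] :
    coeffNumber σ k (s + 2) + Module.finrank ℝ (LinearMap.range (lefCohom hσ k h₁)) =
      hatNumber σ k (s + 2) + betti E M (m + 1) := by
  have := finite_coeff hσ h₀ h₁ hsurj₀ hsurj₁
  have h2 := Submodule.finrank_quotient_add_finrank (connectingRange σ k (s + 2))
  have h3 : Module.finrank ℝ (connectingRange σ k (s + 2)) = _ :=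
    (connectingRangeEquiv hσ h₀ h₁ hsurj₀ hsurj₁).finrank_eq
  have h4 := Submodule.finrank_quotient_add_finrank (LinearMap.range (lefCohom hσ k h₁))
  unfold coeffNumber hatNumber betti
  rw [← h4, ← h3, ← h2]
  ring

theorem finrank_range_lefCohom_le (hσ : d E M 2 σ = 0) {k q m : ℕ} (h : q + 2 * k = m)
    [FiniteDimensional ℝ (DeRham E M m)] :
    Module.finrank ℝ (LinearMap.range (lefCohom hσ k h)) ≤ betti E M m :=
  Submodule.finrank_le _

theorem finrank_range_of_surjective (hσ : d E M 2 σ = 0) {k q m : ℕ} (h : q + 2 * k = m)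
    (hs : Function.Surjective (lefCohom hσ k h)) :
    Module.finrank ℝ (LinearMap.range (lefCohom hσ k h)) = betti E M m := by
  rw [LinearMap.range_eq_top.2 hs, finrank_top, betti]

theorem finrank_range_of_eq_zero (hσ : d E M 2 σ = 0) {k q m : ℕ} (h : q + 2 * k = m)
    (hs : lefCohom hσ k h = 0) :
    Module.finrank ℝ (LinearMap.range (lefCohom hσ k h)) = 0 := by
  rw [hs, LinearMap.range_zero, finrank_bot]

/-- The estimates of the coeffective numbers. -/
theorem coeffNumber_bounds {n k : ℕ} (hn : Module.finrank ℝ E = 2 * n) (hk : 1 ≤ k)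
    (hσ : IsSymplectic σ) {q : ℕ} (hq : n - k + 2 ≤ q)
    [FiniteDimensional ℝ (DeRham E M q)] [FiniteDimensional ℝ (DeRham E M (q + 2 * k))]
    [FiniteDimensional ℝ (DeRham E M (q + 2 * k - 1))] :
    FiniteDimensional ℝ (CoeffCohomology σ k q) ∧
    (betti E M q : ℤ) - betti E M (q + 2 * k) ≤ coeffNumber σ k q ∧
    coeffNumber σ k q ≤ betti E M q + betti E M (q + 2 * k - 1) ∧
    (HardLefschetz n σ → (coeffNumber σ k q : ℤ) = betti E M q - betti E M (q + 2 * k)) ∧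
    (IsExact σ → coeffNumber σ k q = betti E M q + betti E M (q + 2 * k - 1)) := by
  obtain ⟨s, rfl⟩ : ∃ s, q = s + 2 := ⟨q - 2, by omega⟩
  obtain ⟨m, hm⟩ : ∃ m, m = s + 2 * k := ⟨_, rfl⟩
  have e1 : s + 2 + 2 * k = m + 1 + 1 := by omega
  have e2 : s + 2 + 2 * k - 1 = m + 1 := by omega
  have i1 : FiniteDimensional ℝ (DeRham E M (m + 1 + 1)) := e1 ▸ inferInstance
  have i2 : FiniteDimensional ℝ (DeRham E M (m + 1)) := e2 ▸ inferInstance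
  rw [e2, e1]
  have h₀ : s + 2 * k = m := hm.symm
  have h₁ : s + 1 + 2 * k = m + 1 := by omega
  -- With `q = s + 2`, the bound `q ≥ n-k+2` is exactly `s ≥ n-k`, the range in which `L^k` is onto.
  have hs0 := lef_surjective hσ hn h₀ (by omega)
  have hs1 := lef_surjective hσ hn h₁ (by omega)
  have H1 : hatNumber σ k (s + 2) + _ = betti E M (s + 2) :=
    hatNumber_add_finrank_range hσ.1 h₁ e1 hs1
  have H2 := coeffNumber_add_finrank_range hσ.1 h₀ h₁ hs0 hs1
  have H3 := finrank_range_lefCohom_le hσ.1 h₁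
  have H4 := finrank_range_lefCohom_le hσ.1 e1
  refine ⟨finite_coeff hσ.1 h₀ h₁ hs0 hs1, by omega, by omega, fun H => ?_, fun H => ?_⟩
  · have H5 := finrank_range_of_surjective hσ.1 h₁
      (H.lefCohom_surjective hσ.1 hn hk h₁ (by omega))
    have H6 := finrank_range_of_surjective hσ.1 e1
      (H.lefCohom_surjective hσ.1 hn hk e1 (by omega))
    omega
  · have H5 := finrank_range_of_eq_zero hσ.1 h₁ (H.lefCohom_eq_zero hσ.1 hk h₁)
    have H6 := finrank_range_of_eq_zero hσ.1 e1 (H.lefCohom_eq_zero hσ.1 hk e1)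
    omega

/-- The estimates of the number `ĉ_{n-k+1}(M)`. -/
theorem hatNumber_bounds {n k : ℕ} (hn : Module.finrank ℝ E = 2 * n) (hk : 1 ≤ k) (hkn : k ≤ n)
    (hσ : IsSymplectic σ) [FiniteDimensional ℝ (DeRham E M (n - k + 1))]
    [FiniteDimensional ℝ (DeRham E M (n + k + 1))] :
    FiniteDimensional ℝ (HatCohomology σ k (n - k + 1)) ∧
    (betti E M (n - k + 1) : ℤ) - betti E M (n + k + 1) ≤ hatNumber σ k (n - k + 1) ∧
    hatNumber σ k (n - k + 1) ≤ betti E M (n - k + 1) ∧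
    (HardLefschetz n σ → (hatNumber σ k (n - k + 1) : ℤ) =
      betti E M (n - k + 1) - betti E M (n + k + 1)) ∧
    (IsExact σ → hatNumber σ k (n - k + 1) = betti E M (n - k + 1)) := by
  have h₀ : n - k + 2 * k = n + k := by omega
  have h₁ : n - k + 1 + 2 * k = n + k + 1 := by omega
  have hs0 := lef_surjective hσ hn h₀ (by omega)
  have H1 := hatNumber_add_finrank_range hσ.1 h₀ h₁ hs0
  have H4 := finrank_range_lefCohom_le hσ.1 h₁
  refine ⟨finite_hat hσ.1 h₀ h₁ hs0, by omega, by omega, fun H => ?_, fun H => ?_⟩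
  · have H6 := finrank_range_of_surjective hσ.1 h₁
      (H.lefCohom_surjective hσ.1 hn hk h₁ (by omega))
    omega
  · have H6 := finrank_range_of_eq_zero hσ.1 h₁ (H.lefCohom_eq_zero hσ.1 hk h₁)
    omega

end Numbers

/-! ### Smooth dependence of integrals over `[0, 1]` on parameters. -/

section ParametricIntegral

universe u

variable {H : Type u} [NormedAddCommGroup H] [NormedSpace ℝ H] [FiniteDimensional ℝ H]

/-- Dominated differentiation: the partial derivative is continuous, hence bounded, on the compact
product of a small closed ball with `[0, 1]`. -/
theorem hasFDerivAt_integral_of_contDiffAt {F : Type u} [NormedAddCommGroup F] [NormedSpace ℝ F]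
    [CompleteSpace F] {G : H × ℝ → F} {U : Set H} (hU : IsOpen U)
    (hG : ∀ x ∈ U, ∀ t ∈ Icc (0 : ℝ) 1, ContDiffAt ℝ ∞ G (x, t)) {x : H} (hx : x ∈ U) :
    HasFDerivAt (fun y => ∫ t in (0 : ℝ)..1, G (y, t))
      (∫ t in (0 : ℝ)..1, fderiv ℝ G (x, t) ∘L ContinuousLinearMap.inl ℝ H ℝ) x := by
  obtain ⟨ε, hε, hεU⟩ := Metric.nhds_basis_closedBall.mem_iff.1 (hU.mem_nhds hx)
  set K : Set (H × ℝ) := Metric.closedBall x ε ×ˢ Icc (0 : ℝ) 1 with hK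
  have hKc : IsCompact K := (isCompact_closedBall x ε).prod isCompact_Icc
  have hKG : ∀ z ∈ K, ContDiffAt ℝ ∞ G z := fun z hz => hG z.1 (hεU hz.1) z.2 hz.2
  have hD : ContinuousOn (fun z => fderiv ℝ G z ∘L ContinuousLinearMap.inl ℝ H ℝ) K :=
    fun z hz => ((((hKG z hz).fderiv_right (m := ∞) (by simp)).continuousAt).clm_comp
      continuousAt_const).continuousWithinAt
  obtain ⟨C, hC⟩ := hKc.exists_bound_of_continuousOn hD
  have huIcc : uIcc (0 : ℝ) 1 = Icc 0 1 := uIcc_of_le zero_le_one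
  have huIoc : ∀ t ∈ uIoc (0 : ℝ) 1, t ∈ Icc (0 : ℝ) 1 := fun t ht => by
    rw [uIoc_of_le zero_le_one] at ht; exact Ioc_subset_Icc_self ht
  have hcont : ∀ y ∈ Metric.closedBall x ε, ContinuousOn (fun t => G (y, t)) (uIcc (0 : ℝ) 1) := by
    intro y hy t ht
    rw [huIcc] at ht
    exact ((hKG (y, t) ⟨hy, ht⟩).continuousAt.comp (f := fun t : ℝ => (y, t))
      (by fun_prop)).continuousWithinAt
  have hcont' : ContinuousOn (fun t => fderiv ℝ G (x, t) ∘L ContinuousLinearMap.inl ℝ H ℝ)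
      (uIcc (0 : ℝ) 1) := by
    rw [huIcc]
    exact hD.comp (by fun_prop) fun t ht => ⟨Metric.mem_closedBall_self hε.le, ht⟩
  refine intervalIntegral.hasFDerivAt_integral_of_dominated_of_fderiv_le
    (F := fun y t => G (y, t)) (bound := fun _ => C)
    (F' := fun y t => fderiv ℝ G (y, t) ∘L ContinuousLinearMap.inl ℝ H ℝ)
    (Metric.ball_mem_nhds x hε) ?_ ?_ ?_ ?_ ?_ ?_
  · filter_upwards [Metric.ball_mem_nhds x hε] with y hy
    exact (hcont y (Metric.ball_subset_closedBall hy)).intervalIntegrable.def'.aestronglyMeasurable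
  · exact (hcont x (Metric.mem_closedBall_self hε.le)).intervalIntegrable
  · exact hcont'.intervalIntegrable.def'.aestronglyMeasurable
  · exact Filter.Eventually.of_forall fun t ht y hy =>
      hC (y, t) ⟨Metric.ball_subset_closedBall hy, huIoc t ht⟩
  · exact intervalIntegrable_const
  · refine Filter.Eventually.of_forall fun t ht y hy => ?_
    have h1 := ((hKG (y, t) ⟨Metric.ball_subset_closedBall hy, huIoc t ht⟩).differentiableAt
      (by simp)).hasFDerivAt
    exact h1.comp (f := fun y : H => (y, t)) y (hasFDerivAt_prodMk_left y t)

/-- Smooth dependence on parameters of an integral over `[0, 1]`. -/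
theorem contDiffOn_integral {F : Type u} [NormedAddCommGroup F] [NormedSpace ℝ F]
    [CompleteSpace F] {G : H × ℝ → F} {U : Set H} (hU : IsOpen U)
    (hG : ∀ x ∈ U, ∀ t ∈ Icc (0 : ℝ) 1, ContDiffAt ℝ ∞ G (x, t)) :
    ContDiffOn ℝ ∞ (fun y => ∫ t in (0 : ℝ)..1, G (y, t)) U := by
  rw [contDiffOn_infty]
  intro n
  -- The codomain varies because the derivative takes values in `H →L[ℝ] F`; a common universe for
  -- `H` and `F` keeps this space within the scope of the induction.
  induction n generalizing F with
  | zero =>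
    exact contDiffOn_zero.2 fun x hx =>
      (hasFDerivAt_integral_of_contDiffAt hU hG hx).continuousAt.continuousWithinAt
  | succ n ih =>
    push_cast
    rw [contDiffOn_succ_iff_fderiv_of_isOpen hU]
    refine ⟨fun x hx => (hasFDerivAt_integral_of_contDiffAt hU hG
      hx).differentiableAt.differentiableWithinAt, by simp, ?_⟩
    have h1 := ih (G := fun z => fderiv ℝ G z ∘L ContinuousLinearMap.inl ℝ H ℝ)
      fun x hx t ht => ((hG x hx t ht).fderiv_right (m := ∞) (by simp)).clm_comp contDiffAt_const
    exact h1.congr fun x hx => (hasFDerivAt_integral_of_contDiffAt hU hG hx).fderiv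

/-- A continuous linear function of the derivative of an integral over `[0, 1]`. -/
theorem map_fderiv_integral {F F' : Type u} [NormedAddCommGroup F] [NormedSpace ℝ F]
    [CompleteSpace F] [NormedAddCommGroup F'] [NormedSpace ℝ F'] [CompleteSpace F']
    (T : (H →L[ℝ] F) →L[ℝ] F') {G : H × ℝ → F} {U : Set H} (hU : IsOpen U)
    (hG : ∀ x ∈ U, ∀ t ∈ Icc (0 : ℝ) 1, ContDiffAt ℝ ∞ G (x, t)) {x : H} (hx : x ∈ U)
    {D : ℝ → H →L[ℝ] F} (hD : ∀ t ∈ Icc (0 : ℝ) 1, HasFDerivAt (fun y => G (y, t)) (D t) x)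
    {P : ℝ → F'} (hP : ∀ t ∈ Icc (0 : ℝ) 1, HasDerivAt P (T (D t)) t) :
    T (fderiv ℝ (fun y => ∫ t in (0 : ℝ)..1, G (y, t)) x) = P 1 - P 0 := by
  have hDG : EqOn (fun t => fderiv ℝ G (x, t) ∘L ContinuousLinearMap.inl ℝ H ℝ) D
      (uIcc (0 : ℝ) 1) := by
    rw [uIcc_of_le zero_le_one]
    intro t ht
    exact (((hG x hx t ht).differentiableAt (by simp)).hasFDerivAt.comp
      (f := fun y : H => (y, t)) x (hasFDerivAt_prodMk_left x t)).unique (hD t ht)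
  have hcont : ContinuousOn (fun t => fderiv ℝ G (x, t) ∘L ContinuousLinearMap.inl ℝ H ℝ)
      (uIcc (0 : ℝ) 1) := by
    rw [uIcc_of_le zero_le_one]
    intro t ht
    have h1 := ((hG x hx t ht).fderiv_right (m := ∞) (by simp)).continuousAt
    exact ((h1.clm_comp continuousAt_const).comp (f := fun t : ℝ => (x, t))
      (by fun_prop)).continuousWithinAt
  have hcontD : ContinuousOn D (uIcc (0 : ℝ) 1) := hcont.congr hDG.symm
  rw [(hasFDerivAt_integral_of_contDiffAt hU hG hx).fderiv, intervalIntegral.integral_congr hDG,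
    ← ContinuousLinearMap.intervalIntegral_comp_comm _ hcontD.intervalIntegrable]
  refine intervalIntegral.integral_eq_sub_of_hasDerivAt (fun t ht => hP t ?_)
    (T.continuous.comp_continuousOn hcontD).intervalIntegrable
  rwa [uIcc_of_le zero_le_one] at ht

end ParametricIntegral

/-! ### The Poincaré lemma on star-shaped open sets. -/

section Poincare

/-- Derivative of `y ↦ t^q L (f (t y)) y`. -/
theorem hasFDerivAt_homotopy {E F F' : Type*} [NormedAddCommGroup E] [NormedSpace ℝ E]
    [NormedAddCommGroup F] [NormedSpace ℝ F] [NormedAddCommGroup F'] [NormedSpace ℝ F']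
    (L : F' →L[ℝ] E →L[ℝ] F) (q : ℕ) {f : E → F'} {t : ℝ} {x : E}
    (hf : DifferentiableAt ℝ f (t • x)) :
    HasFDerivAt (fun y => t ^ q • L (f (t • y)) y)
      (t ^ q • (t • (L.flip x ∘L fderiv ℝ f (t • x)) + L (f (t • x)))) x := by
  have h1 : HasFDerivAt (fun y => f (t • y)) (t • fderiv ℝ f (t • x)) x := by
    have := hf.hasFDerivAt.comp x ((hasFDerivAt_id x).const_smul t)
    refine this.congr_fderiv ?_
    ext u
    simp
  have h2 := (L.hasFDerivAt.comp x h1).clm_apply (hasFDerivAt_id x)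
  refine (h2.const_smul (t ^ q)).congr_fderiv ?_
  ext u
  simp [add_comm]

/-- Derivative of `t ↦ t^{q+1} f (t x)`. -/
theorem hasDerivAt_pow_smul {E F : Type*} [NormedAddCommGroup E] [NormedSpace ℝ E]
    [NormedAddCommGroup F] [NormedSpace ℝ F] (q : ℕ) {f : E → F} {t : ℝ} {x : E}
    (hf : DifferentiableAt ℝ f (t • x)) :
    HasDerivAt (fun s : ℝ => s ^ (q + 1) • f (s • x))
      (t ^ q • (t • fderiv ℝ f (t • x) x + ((q : ℝ) + 1) • f (t • x))) t := by
  have h1 : HasDerivAt (fun s : ℝ => f (s • x)) (fderiv ℝ f (t • x) x) t := by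
    have h2 : HasDerivAt (fun s : ℝ => s • x) x t := by
      simpa using (hasDerivAt_id t).smul_const x
    exact hf.hasFDerivAt.comp_hasDerivAt t h2
  refine ((hasDerivAt_pow (q + 1) t).fun_smul h1).congr_deriv ?_
  rw [smul_add, smul_smul, smul_smul, pow_succ]
  push_cast
  congr 2
  simp [mul_comm]

universe u

variable {E : Type u} [NormedAddCommGroup E] [NormedSpace ℝ E]

/-- The contraction `v ↦ α (v, ·)` as a continuous linear map of `α`. -/
def curryLeftCLM (E : Type u) [NormedAddCommGroup E] [NormedSpace ℝ E] (q : ℕ) :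
    (E [⋀^Fin (q + 1)]→L[ℝ] ℝ) →L[ℝ] E →L[ℝ] E [⋀^Fin q]→L[ℝ] ℝ :=
  (ContinuousAlternatingMap.curryLeftLI (𝕜 := ℝ) (E := E) (F := ℝ) (n := q)).toContinuousLinearMap

/-- The pointwise form of Cartan's formula for a constant vector `x`: in the alternating sum for `A`
evaluated at `(x, v)`, the zeroth term is `A x v` and the others form the left side with opposite
sign. -/
theorem alternatizeUncurryFin_contract {q : ℕ} (A : E →L[ℝ] E [⋀^Fin (q + 1)]→L[ℝ] ℝ) (x : E) :
    ContinuousAlternatingMap.alternatizeUncurryFin ((curryLeftCLM E q).flip x ∘L A) =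
      A x - (ContinuousAlternatingMap.alternatizeUncurryFin A).curryLeft x := by
  ext v
  rw [ContinuousAlternatingMap.sub_apply, ContinuousAlternatingMap.curryLeft_apply_apply,
    ContinuousAlternatingMap.alternatizeUncurryFin_apply,
    ContinuousAlternatingMap.alternatizeUncurryFin_apply, Fin.sum_univ_succ (n := q + 1)]
  have h : ∀ i : Fin (q + 1), i.succ.removeNth (Matrix.vecCons x v) =
      Matrix.vecCons x (i.removeNth v) := by
    intro i
    funext j
    refine Fin.cases ?_ (fun j => ?_) j
    · simp [Fin.removeNth]
    · simp [Fin.removeNth, Fin.succ_succAbove_succ]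
  have h0 : (0 : Fin (q + 2)).removeNth (Matrix.vecCons x v) = v := by
    funext j
    simp [Fin.removeNth]
  simp only [h, h0, Matrix.cons_val_zero, Matrix.cons_val_succ, Fin.val_zero, Fin.val_succ,
    pow_zero, one_smul, pow_succ, mul_neg, mul_one, neg_smul, Finset.sum_neg_distrib]
  rw [sub_add_eq_sub_sub, sub_self, zero_sub, neg_neg]
  rfl

variable [FiniteDimensional ℝ E]

/-- The Poincaré lemma on a star-shaped open set. -/
theorem exists_primitive {q : ℕ} {U : Set E} (hU : IsOpen U) (hs : StarConvex ℝ 0 U)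
    {f : E → E [⋀^Fin (q + 1)]→L[ℝ] ℝ} (hf : ContDiffOn ℝ ∞ f U)
    (hd : ∀ x ∈ U, extDeriv f x = 0) :
    ∃ g : E → E [⋀^Fin q]→L[ℝ] ℝ, ContDiffOn ℝ ∞ g U ∧ ∀ x ∈ U, extDeriv g x = f x := by
  have hsU : ∀ x ∈ U, ∀ t ∈ Icc (0 : ℝ) 1, t • x ∈ U := fun x hx t ht =>
    hs.smul_mem hx ht.1 ht.2
  have hfa : ∀ x ∈ U, ContDiffAt ℝ ∞ f x := fun x hx => hf.contDiffAt (hU.mem_nhds hx)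
  have hfd : ∀ x ∈ U, ∀ t ∈ Icc (0 : ℝ) 1, DifferentiableAt ℝ f (t • x) := fun x hx t ht =>
    (hfa _ (hsU x hx t ht)).differentiableAt (by simp)
  -- The radial homotopy: the primitive is `∫₀¹ t^q ι_x f(tx) dt`.
  set G : E × ℝ → E [⋀^Fin q]→L[ℝ] ℝ :=
    fun z => z.2 ^ q • curryLeftCLM E q (f (z.2 • z.1)) z.1 with hGdef
  have hG : ∀ x ∈ U, ∀ t ∈ Icc (0 : ℝ) 1, ContDiffAt ℝ ∞ G (x, t) := by
    intro x hx t ht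
    have h1 : ContDiffAt ℝ ∞ (fun z : E × ℝ => f (z.2 • z.1)) (x, t) :=
      ContDiffAt.comp (g := f) (f := fun z : E × ℝ => z.2 • z.1) (x, t) (hfa _ (hsU x hx t ht))
        (contDiffAt_snd.smul contDiffAt_fst)
    exact (contDiffAt_snd.pow q).smul
      ((contDiff_curryLeft.contDiffAt.comp (x, t) h1).clm_apply contDiffAt_fst)
  refine ⟨fun x => ∫ t in (0 : ℝ)..1, G (x, t), contDiffOn_integral hU hG, fun x hx => ?_⟩
  -- Since `df = 0`, the exterior derivative of the integrand is `d/dt (t^{q+1} f(tx))`. Integration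
  -- leaves `f(x)`; the boundary term at `t = 0` vanishes because the exponent is positive.
  have hval : ∀ t ∈ Icc (0 : ℝ) 1, ContinuousAlternatingMap.alternatizeUncurryFinCLM ℝ E ℝ
      (t ^ q • (t • ((curryLeftCLM E q).flip x ∘L fderiv ℝ f (t • x)) +
        curryLeftCLM E q (f (t • x)))) =
      t ^ q • (t • fderiv ℝ f (t • x) x + ((q : ℝ) + 1) • f (t • x)) := by
    intro t ht
    rw [map_smul, map_add, map_smul]
    have h3 : ContinuousAlternatingMap.alternatizeUncurryFin (fderiv ℝ f (t • x)) = 0 :=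
      hd _ (hsU x hx t ht)
    have h4 := alternatizeUncurryFin_contract (fderiv ℝ f (t • x)) x
    rw [h3, ContinuousAlternatingMap.curryLeft_zero] at h4
    have h5 := ContinuousAlternatingMap.alternatizeUncurryFin_curryLeft (f (t • x))
    congr 2
    · refine congrArg (t • ·) (h4.trans ?_)
      exact sub_zero _
    · refine h5.trans ?_
      rw [← Nat.cast_smul_eq_nsmul ℝ]
      push_cast
      rfl
  have h := map_fderiv_integral (F := E [⋀^Fin q]→L[ℝ] ℝ) (F' := E [⋀^Fin (q + 1)]→L[ℝ] ℝ)
    (ContinuousAlternatingMap.alternatizeUncurryFinCLM ℝ E ℝ) hU hG hx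
    (fun t ht => hasFDerivAt_homotopy (curryLeftCLM E q) q (hfd x hx t ht))
    (P := fun s : ℝ => s ^ (q + 1) • f (s • x))
    (fun t ht => (hval t ht).symm ▸ hasDerivAt_pow_smul q (hfd x hx t ht))
  refine h.trans ?_
  simp

end Poincare

/-! ### Forms on an open subset of a vector space. -/

section OpenSubset

universe u

variable {E : Type u} [NormedAddCommGroup E] [NormedSpace ℝ E] {U : TopologicalSpace.Opens E}

/-- Every preferred chart of `U` is the inclusion into `E`, so one chart covers `U`. -/
theorem extChartAt_opens_source (x₀ : U) : (extChartAt 𝓘(ℝ, E) x₀).source = univ := by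
  ext x
  simp only [mem_univ, iff_true]
  exact mem_extChartAt_source (I := 𝓘(ℝ, E)) x

theorem extChartAt_opens_target (x₀ : U) : (extChartAt 𝓘(ℝ, E) x₀).target = U := by
  rw [← (extChartAt 𝓘(ℝ, E) x₀).image_source_eq_target, extChartAt_opens_source, image_univ]
  exact Subtype.range_coe

theorem coe_extChartAt_opens_symm (x₀ : U) {y : E} (hy : y ∈ (extChartAt 𝓘(ℝ, E) x₀).target) :
    (((extChartAt 𝓘(ℝ, E) x₀).symm y : U) : E) = y :=
  (extChartAt 𝓘(ℝ, E) x₀).right_inv hy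

theorem mfderiv_extChartAt_comp_symm (x₀ : U) {y : E}
    (hy : y ∈ (extChartAt 𝓘(ℝ, E) x₀).target) :
    (mfderiv 𝓘(ℝ, E) 𝓘(ℝ, E) (extChartAt 𝓘(ℝ, E) x₀) ((extChartAt 𝓘(ℝ, E) x₀).symm y)).comp
      (mfderiv 𝓘(ℝ, E) 𝓘(ℝ, E) (extChartAt 𝓘(ℝ, E) x₀).symm y) = ContinuousLinearMap.id ℝ E := by
  rw [← fderiv_trans hy (by rw [extChartAt_opens_source]; trivial)]
  have hev : trans E x₀ x₀ =ᶠ[nhds y] id := by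
    filter_upwards [(isOpen_extChartAt_target x₀).mem_nhds hy] with z hz
    exact coe_extChartAt_opens_symm x₀ hz
  rw [hev.fderiv_eq, fderiv_id]

/-- A form on an open subset of `E` given by its coefficients. -/
def ofCoefficients {q : ℕ} (x₀ : U) (g : E → E [⋀^Fin q]→L[ℝ] ℝ) : RawForm E U q := fun x =>
  (g x).compContinuousLinearMap (mfderiv 𝓘(ℝ, E) 𝓘(ℝ, E) (extChartAt 𝓘(ℝ, E) x₀) x)

/-- All charts being the inclusion, the derivatives of one chart and of the inverse of another
compose to the identity, and `g` is recovered in every chart. -/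
theorem chartRep_ofCoefficients {q : ℕ} (x₀ x₁ : U) (g : E → E [⋀^Fin q]→L[ℝ] ℝ) {y : E}
    (hy : y ∈ (extChartAt 𝓘(ℝ, E) x₁).target) : chartRep (ofCoefficients x₀ g) x₁ y = g y := by
  ext v
  have h1 : ∀ u : E, (mfderiv 𝓘(ℝ, E) 𝓘(ℝ, E) (extChartAt 𝓘(ℝ, E) x₀)
      ((extChartAt 𝓘(ℝ, E) x₁).symm y) : E →L[ℝ] E)
      ((mfderiv 𝓘(ℝ, E) 𝓘(ℝ, E) (extChartAt 𝓘(ℝ, E) x₁).symm y : E →L[ℝ] E) u) = u := fun u =>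
    congrArg (fun A : E →L[ℝ] E => A u) (mfderiv_extChartAt_comp_symm x₁ hy)
  have h2 : chartRep (ofCoefficients x₀ g) x₁ y v = g ((extChartAt 𝓘(ℝ, E) x₁).symm y : U) v :=
    congrArg (g ((extChartAt 𝓘(ℝ, E) x₁).symm y : U)) (funext fun i => h1 (v i))
  rw [h2, coe_extChartAt_opens_symm x₁ hy]

variable [FiniteDimensional ℝ E]

/-- Closed forms of positive degree on a star-shaped open set are exact. -/
theorem exists_d_eq {q : ℕ} (h0 : (0 : E) ∈ U) (hs : StarConvex ℝ 0 (U : Set E))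
    {α : Form E U (q + 1)} (hα : d E U (q + 1) α = 0) : ∃ β : Form E U q, d E U q β = α := by
  let x₀ : U := ⟨0, h0⟩
  have ht := extChartAt_opens_target x₀
  obtain ⟨g, hg, hd⟩ := exists_primitive (f := chartRep α.1 x₀) U.isOpen hs
    (by rw [← ht]; exact α.2 x₀) fun y hy => by
      rw [← chartRep_d α (x₀ := x₀) (by rwa [ht]), hα]; rfl
  refine ⟨⟨ofCoefficients x₀ g, fun x₁ => ?_⟩, Form.ext_chartRep fun x₁ y hy => ?_⟩
  · refine ContDiffOn.congr ?_ fun y hy => chartRep_ofCoefficients x₀ x₁ g hy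
    rwa [extChartAt_opens_target]
  · rw [chartRep_d _ hy]
    have hev : chartRep (ofCoefficients x₀ g) x₁ =ᶠ[nhds y] g := by
      filter_upwards [(isOpen_extChartAt_target x₁).mem_nhds hy] with z hz
      exact chartRep_ofCoefficients x₀ x₁ g hz
    refine hev.extDeriv_eq.trans ((hd y ?_).trans rfl)
    rwa [extChartAt_opens_target] at hy

theorem subsingleton_deRham (h0 : (0 : E) ∈ U) (hs : StarConvex ℝ 0 (U : Set E)) {q : ℕ}
    (hq : 1 ≤ q) : Subsingleton (DeRham E U q) := by
  obtain ⟨q, rfl⟩ : ∃ p, q = p + 1 := ⟨q - 1, by omega⟩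
  refine Submodule.Quotient.subsingleton_iff.2 (eq_top_iff.2 fun α _ => ?_)
  obtain ⟨β, hβ⟩ := exists_d_eq h0 hs (mem_cocycles_allForms.1 α.2)
  exact mem_coboundaries_allForms_succ.2 ⟨β, hβ⟩

end OpenSubset

/-! ### The standard symplectic form on the disk. -/

section StandardForm

variable {n : ℕ}

theorem zero_mem_disk (n : ℕ) : (0 : EuclideanSpace ℝ (Fin (2 * n))) ∈ disk n :=
  Metric.mem_ball_self one_pos

theorem subsingleton_deRham_disk (n : ℕ) {q : ℕ} (hq : 1 ≤ q) :
    Subsingleton (DeRham (EuclideanSpace ℝ (Fin (2 * n))) (disk n) q) :=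
  subsingleton_deRham (zero_mem_disk n)
    ((convex_ball 0 1).starConvex (Metric.mem_ball_self one_pos)) hq

/-- Evaluation of forms at a point. -/
def evalForm {E : Type*} [NormedAddCommGroup E] [NormedSpace ℝ E] {M : Type*} [TopologicalSpace M]
    [ChartedSpace E M] (q : ℕ) (x : M) : Form E M q →ₗ[ℝ] E [⋀^Fin q]→L[ℝ] ℝ where
  toFun α := α.1 x
  map_add' _ _ := rfl
  map_smul' _ _ := rfl

/-- In the chart the coordinate function is a continuous linear functional, which is its own
derivative. -/
theorem dx_apply (i : Fin (2 * n)) (x : disk n) :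
    evalForm 1 x (dx n i) = oneForm ((EuclideanSpace.proj i : _ →L[ℝ] ℝ) ∘L
      (mfderiv 𝓘(ℝ, EuclideanSpace ℝ (Fin (2 * n))) 𝓘(ℝ, EuclideanSpace ℝ (Fin (2 * n)))
        (extChartAt 𝓘(ℝ, EuclideanSpace ℝ (Fin (2 * n))) x) x :
        EuclideanSpace ℝ (Fin (2 * n)) →L[ℝ] EuclideanSpace ℝ (Fin (2 * n)))) := by
  have hev : chartRep (ofFun (coord n i)).1 x
      =ᶠ[nhds (extChartAt 𝓘(ℝ, EuclideanSpace ℝ (Fin (2 * n))) x x)]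
      fun y => ContinuousAlternatingMap.constOfIsEmpty ℝ (EuclideanSpace ℝ (Fin (2 * n))) (Fin 0)
        ((EuclideanSpace.proj i : _ →L[ℝ] ℝ) y) := by
    filter_upwards [(isOpen_extChartAt_target x).mem_nhds
      (mem_extChartAt_target (I := 𝓘(ℝ, EuclideanSpace ℝ (Fin (2 * n)))) x)] with y hy
    ext v
    exact congrArg (fun z : EuclideanSpace ℝ (Fin (2 * n)) => z i)
      (coe_extChartAt_opens_symm x hy)
  have h := hev.extDeriv_eq
  rw [extDeriv_constOfIsEmpty, ContinuousLinearMap.fderiv] at h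
  ext v
  exact congrArg (fun η : EuclideanSpace ℝ (Fin (2 * n)) [⋀^Fin 1]→L[ℝ] ℝ => η fun j =>
    (mfderiv 𝓘(ℝ, EuclideanSpace ℝ (Fin (2 * n))) 𝓘(ℝ, EuclideanSpace ℝ (Fin (2 * n)))
        (extChartAt 𝓘(ℝ, EuclideanSpace ℝ (Fin (2 * n))) x) x :
        EuclideanSpace ℝ (Fin (2 * n)) →L[ℝ] EuclideanSpace ℝ (Fin (2 * n))) (v j)) h

theorem d_wedge_dx (i j : Fin (2 * n)) :
    d (EuclideanSpace ℝ (Fin (2 * n))) (disk n) 2 (wedge (dx n i) (dx n j)) = 0 := by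
  have h : ∀ l, d (EuclideanSpace ℝ (Fin (2 * n))) (disk n) 1 (dx n l) = 0 := fun l => d_d _
  have h1 := d_wedge_one (dx n i) (dx n j)
  rw [h, h] at h1
  refine h1.trans ?_
  have h2 : wedge (0 : Form (EuclideanSpace ℝ (Fin (2 * n))) (disk n) 2) (dx n j) = 0 :=
    map_zero (wedgeRight 2 (dx n j))
  have h3 : wedge (dx n i) (0 : Form (EuclideanSpace ℝ (Fin (2 * n))) (disk n) 2) = 0 :=
    Subtype.ext (funext fun x => map_zero (wedgeCLM (EuclideanSpace ℝ (Fin (2 * n))) 1 2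
      ((dx n i).1 x)))
  rw [h2, h3, smul_zero, add_zero]

/-- `A` is the derivative of the chart at `x`. Nondegeneracy only needs its invertibility, so it is
never identified with the identity. -/
theorem exists_equiv_stdForm_apply (x : disk n) :
    ∃ A : EuclideanSpace ℝ (Fin (2 * n)) ≃L[ℝ] EuclideanSpace ℝ (Fin (2 * n)),
    ∀ v w, evalForm 2 x (stdForm n) ![v, w] = ∑ i : Fin n,
      ((A v) ⟨i, by omega⟩ * (A w) ⟨n + i, by omega⟩ -
        (A v) ⟨n + i, by omega⟩ * (A w) ⟨i, by omega⟩) := by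
  obtain ⟨A, hA⟩ : ∃ A : EuclideanSpace ℝ (Fin (2 * n)) ≃L[ℝ] EuclideanSpace ℝ (Fin (2 * n)),
      (A : EuclideanSpace ℝ (Fin (2 * n)) →L[ℝ] EuclideanSpace ℝ (Fin (2 * n))) =
        mfderiv 𝓘(ℝ, EuclideanSpace ℝ (Fin (2 * n))) 𝓘(ℝ, EuclideanSpace ℝ (Fin (2 * n)))
          (extChartAt 𝓘(ℝ, EuclideanSpace ℝ (Fin (2 * n))) x) x :=
    isInvertible_mfderiv_extChartAt (I := 𝓘(ℝ, EuclideanSpace ℝ (Fin (2 * n))))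
      (mem_extChartAt_source (I := 𝓘(ℝ, EuclideanSpace ℝ (Fin (2 * n)))) x)
  refine ⟨A, fun v w => ?_⟩
  rw [stdForm, map_sum, ContinuousAlternatingMap.sum_apply]
  refine Finset.sum_congr rfl fun i _ => ?_
  have h : ∀ a b : Fin (2 * n), evalForm 2 x (wedge (dx n a) (dx n b)) ![v, w] =
      A v a * A w b - A v b * A w a := by
    intro a b
    have h1 : evalForm 2 x (wedge (dx n a) (dx n b)) =
      wedgeAlt (evalForm 1 x (dx n a)) (evalForm 1 x (dx n b)) := rfl
    rw [h1, dx_apply, dx_apply, wedgeAlt_oneForm_oneForm_apply, ← hA]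
    rfl
  exact h _ _

theorem isSymplectic_stdForm (n : ℕ) : IsSymplectic (stdForm n) := by
  refine ⟨?_, fun x v hv => ?_⟩
  · rw [stdForm, map_sum]
    exact Finset.sum_eq_zero fun i _ => d_wedge_dx _ _
  · obtain ⟨A, hA⟩ := exists_equiv_stdForm_apply x
    set z : EuclideanSpace ℝ (Fin (2 * n)) := A v with hz
    have h : ∀ u : EuclideanSpace ℝ (Fin (2 * n)), ∑ i : Fin n,
        (z ⟨i, by omega⟩ * u ⟨n + i, by omega⟩ - z ⟨n + i, by omega⟩ * u ⟨i, by omega⟩) = 0 := by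
      intro u
      have h1 := (hA v (A.symm u)).symm.trans (hv (A.symm u))
      simpa using h1
    -- The test vector is `z` rotated by the standard complex structure; it turns the pairing into
    -- the sum of the squares of the coordinates of `z`.
    have h2 := h (WithLp.toLp 2 fun j => if hj : (j : ℕ) < n then -z ⟨n + j, by omega⟩
      else z ⟨j - n, by omega⟩)
    simp only [Nat.add_sub_cancel_left, Fin.is_lt, dif_pos,
      show ∀ i : ℕ, ¬ (n + i < n) from fun i => by omega, dif_neg, not_false_eq_true] at h2
    have h5 := (Finset.sum_eq_zero_iff_of_nonneg fun i _ => by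
      rw [mul_neg, sub_neg_eq_add]
      exact add_nonneg (mul_self_nonneg _) (mul_self_nonneg _)).1 h2
    have h3 : z = 0 := by
      ext j
      by_cases hj : (j : ℕ) < n
      · have := h5 ⟨j, hj⟩ (Finset.mem_univ _)
        simp only at this
        have h4 : z ⟨j, by omega⟩ = 0 := by
          nlinarith [sq_nonneg (z ⟨j, by omega⟩), sq_nonneg (z ⟨n + j, by omega⟩)]
        exact h4
      · have := h5 ⟨j - n, by omega⟩ (Finset.mem_univ _)
        have e : n + (j - n : ℕ) = j := by omega
        simp only [e] at this
        have h4 : z j = 0 := by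
          nlinarith [sq_nonneg (z ⟨j - n, by omega⟩), sq_nonneg (z j)]
        exact h4
    exact (map_eq_zero_iff A A.injective).1 h3

end StandardForm

/-! ### Vanishing of the numbers on the disk. -/

section DiskNumbers

variable {n k : ℕ}

theorem finiteDimensional_deRham_disk (n : ℕ) {q : ℕ} (hq : 1 ≤ q) :
    FiniteDimensional ℝ (DeRham (EuclideanSpace ℝ (Fin (2 * n))) (disk n) q) :=
  have := subsingleton_deRham_disk n hq
  inferInstance

theorem betti_disk (n : ℕ) {q : ℕ} (hq : 1 ≤ q) :
    betti (EuclideanSpace ℝ (Fin (2 * n))) (disk n) q = 0 :=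
  have := subsingleton_deRham_disk n hq
  Module.finrank_zero_of_subsingleton

/-- The upper bound suffices: both Betti numbers in it have positive degree, so the nonzero `H^0`
never enters. -/
theorem coeffNumber_stdForm (hk : 1 ≤ k) {q : ℕ} (hq : n - k + 2 ≤ q) :
    FiniteDimensional ℝ (CoeffCohomology (stdForm n) k q) ∧ coeffNumber (stdForm n) k q = 0 := by
  have := finiteDimensional_deRham_disk n (q := q) (by omega)
  have := finiteDimensional_deRham_disk n (q := q + 2 * k) (by omega)
  have := finiteDimensional_deRham_disk n (q := q + 2 * k - 1) (by omega)
  have h := coeffNumber_bounds (n := n) (by simp) hk (isSymplectic_stdForm n) hq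
  refine ⟨h.1, Nat.le_zero.1 (h.2.2.1.trans_eq ?_)⟩
  rw [betti_disk n (by omega), betti_disk n (by omega)]

theorem hatNumber_stdForm (hk : 1 ≤ k) (hkn : k ≤ n) :
    FiniteDimensional ℝ (HatCohomology (stdForm n) k (n - k + 1)) ∧
      hatNumber (stdForm n) k (n - k + 1) = 0 := by
  have := finiteDimensional_deRham_disk n (q := n - k + 1) (by omega)
  have := finiteDimensional_deRham_disk n (q := n + k + 1) (by omega)
  have h := hatNumber_bounds (n := n) (by simp) hk hkn (isSymplectic_stdForm n)
  exact ⟨h.1, Nat.le_zero.1 (h.2.2.1.trans_eq (betti_disk n (by omega)))⟩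

end DiskNumbers

end Coeff

end

theorem mainTheorem4 (n k : ℕ) (hk : 1 ≤ k) (hkn : k ≤ n) :
    -- `(M, σ)` a symplectic manifold of dimension `2n` of finite type
    (∀ (M : Type*) [TopologicalSpace M] [T2Space M] [SecondCountableTopology M]
        [ChartedSpace (EuclideanSpace ℝ (Fin (2 * n))) M]
        [IsManifold 𝓘(ℝ, EuclideanSpace ℝ (Fin (2 * n))) ∞ M]
        (σ : Coeff.Form (EuclideanSpace ℝ (Fin (2 * n))) M 2),
        Coeff.IsSymplectic σ →
        Coeff.IsFiniteType (EuclideanSpace ℝ (Fin (2 * n))) M →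
        -- the groups `H^q_{(k)}(M)`, `q ≥ n - k + 2`
        (∀ q : ℕ, n - k + 2 ≤ q →
          FiniteDimensional ℝ (Coeff.CoeffCohomology σ k q) ∧
          ((Coeff.betti (EuclideanSpace ℝ (Fin (2 * n))) M q : ℤ) -
              Coeff.betti (EuclideanSpace ℝ (Fin (2 * n))) M (q + 2 * k) ≤
            Coeff.coeffNumber σ k q) ∧
          (Coeff.coeffNumber σ k q ≤
            Coeff.betti (EuclideanSpace ℝ (Fin (2 * n))) M q +
              Coeff.betti (EuclideanSpace ℝ (Fin (2 * n))) M (q + 2 * k - 1)) ∧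
          (Coeff.HardLefschetz n σ →
            (Coeff.coeffNumber σ k q : ℤ) =
              Coeff.betti (EuclideanSpace ℝ (Fin (2 * n))) M q -
                Coeff.betti (EuclideanSpace ℝ (Fin (2 * n))) M (q + 2 * k)) ∧
          (Coeff.IsExact σ →
            Coeff.coeffNumber σ k q =
              Coeff.betti (EuclideanSpace ℝ (Fin (2 * n))) M q +
                Coeff.betti (EuclideanSpace ℝ (Fin (2 * n))) M (q + 2 * k - 1))) ∧
        -- the space `Ĥ^{n-k+1}(M)`
        (FiniteDimensional ℝ (Coeff.HatCohomology σ k (n - k + 1)) ∧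
          ((Coeff.betti (EuclideanSpace ℝ (Fin (2 * n))) M (n - k + 1) : ℤ) -
              Coeff.betti (EuclideanSpace ℝ (Fin (2 * n))) M (n + k + 1) ≤
            Coeff.hatNumber σ k (n - k + 1)) ∧
          (Coeff.hatNumber σ k (n - k + 1) ≤
            Coeff.betti (EuclideanSpace ℝ (Fin (2 * n))) M (n - k + 1)) ∧
          (Coeff.HardLefschetz n σ →
            (Coeff.hatNumber σ k (n - k + 1) : ℤ) =
              Coeff.betti (EuclideanSpace ℝ (Fin (2 * n))) M (n - k + 1) -
                Coeff.betti (EuclideanSpace ℝ (Fin (2 * n))) M (n + k + 1)) ∧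
          (Coeff.IsExact σ →
            Coeff.hatNumber σ k (n - k + 1) =
              Coeff.betti (EuclideanSpace ℝ (Fin (2 * n))) M (n - k + 1)))) ∧
    -- the unit disk with the standard symplectic form
    (∀ q : ℕ, n - k + 2 ≤ q →
      FiniteDimensional ℝ (Coeff.CoeffCohomology (Coeff.stdForm n) k q) ∧
      Coeff.coeffNumber (Coeff.stdForm n) k q = 0) ∧
    FiniteDimensional ℝ (Coeff.HatCohomology (Coeff.stdForm n) k (n - k + 1)) ∧
    Coeff.hatNumber (Coeff.stdForm n) k (n - k + 1) = 0 := by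
  have hn : Module.finrank ℝ (EuclideanSpace ℝ (Fin (2 * n))) = 2 * n := by simp
  refine ⟨fun M _ _ _ _ _ σ hσ hft => ⟨fun q hq => ?_, ?_⟩,
    fun q hq => Coeff.coeffNumber_stdForm hk hq, Coeff.hatNumber_stdForm hk hkn⟩
  · have := hft q
    have := hft (q + 2 * k)
    have := hft (q + 2 * k - 1)
    exact Coeff.coeffNumber_bounds hn hk hσ hq
  · have := hft (n - k + 1)
    have := hft (n + k + 1)
    exact Coeff.hatNumber_bounds hn hk hkn hσ
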